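/- Fix $T>0$. Let $X$ be the set of sequences $a=(a_1,a_2,\dots)$ of bounded measurable functions $a_i:[0,T]\to\mathbf C$ with $\sup_{x\in[0,T],\,i\ge 1}|a_i(x)|^{1/i}<\infty$. Let $\mathcal A$ be the algebra of formal series $$f=c_0I+\sum_{n=1}^{\infty}\Big(\sum_{i_1+\dots+i_k=n}c_{i_1,\dots,i_k}X_{i_1}\cdots X_{i_k}\Big)t^n,\qquad c_0,\,c_{i_1,\dots,i_k}\in\mathbf C,$$ in free noncommutative variables $X_1,X_2,\dots$ and a central variable $t$, with the weakest topology in which all coefficients are continuous functions of $f$, and let $G\subset\mathcal A$ be the topological group of all $f\in\mathcal A$ with $c_0=1$. For $a\in X$ let $E(a)=F_a(T)\in G$, where $F_a:[0,T]\to G$ is the solution (obtained by Picard iteration, so that its coefficients are iterated integrals of the $a_i$) of $$F'(x)=\Big(\sum_{i\ge1}a_i(x)t^iX_i\Big)F(x),\qquad F(0)=I.$$ The set $G(X)=\{E(a):a\in X\}$ is a subgroup of $G$; let $G_f(X)$ (the group of formal paths) be its closure in $G$. Let $\mathcal L_{Lie}\subset\mathcal A$ be the Lie algebra, with bracket $[f,g]=fg-gf$,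 of all Lie elements, that is, of all series $g=\sum_{n\ge1}g_nt^n\in\mathcal A$ such that each $g_n$ belongs to the free Lie algebra generated by $X_1,\dots,X_n$. For $f\in\mathcal A$ with $c_0=0$ put $e^f=\sum_{n\ge0}f^n/n!$, and for $f\in G$ put $\log f=-\sum_{n\ge1}(I-f)^n/n$. **Proposition.** Let $R\subset\mathcal L_{Lie}$ be any subset, let $A_R$ be the minimal closed (complex) Lie subalgebra of $\mathcal L_{Lie}$ containing $R$, and let $H_R$ be the subgroup of $G$ generated by all $e^{cr}$ with $r\in R$ and $c\in\mathbf C$. Then $H_R\subset G_f(X)$, and the closure $\overline H_R$ of $H_R$ in $G_f(X)$ satisfies $$\log(\overline H_R)=A_R.$$ Moreover, $\overline H_R$ is a normal subgroup of $G_f(X)$ if and only if $A_R$ is an ideal of $\mathcal L_{Lie}$. -/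

import Mathlib

noncomputable section

/-- The complex algebra `𝒜` of noncommutative formal power series
`c₀ I + ∑_{n ≥ 1} (∑_{i₁ + ⋯ + iₖ = n} c_{i₁, …, iₖ} X_{i₁} ⋯ X_{iₖ}) tⁿ`
in the free variables `X₁, X₂, …`.  The exponent of `t` is the weight `i₁ + ⋯ + iₖ` of the
monomial, so such a series is the same thing as the family of its coefficients, indexed by all
words `[i₁, …, iₖ]` (the empty word giving `c₀`). The letter `i` stands for `X_i tⁱ`. -/
structure FormalSeries : Type where
  /-- The coefficient of a word. -/
  coeff : List ℕ+ → ℂ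

namespace FormalSeries

instance : CoeFun FormalSeries (fun _ => List ℕ+ → ℂ) := ⟨coeff⟩

theorem coeff_injective : Function.Injective coeff := fun ⟨_⟩ ⟨_⟩ h => congrArg mk h

@[ext] theorem ext {f g : FormalSeries} (h : ∀ w, f w = g w) : f = g :=
  coeff_injective (funext h)

instance : Zero FormalSeries := ⟨⟨fun _ => 0⟩⟩
instance : Add FormalSeries := ⟨fun f g => ⟨fun w => f w + g w⟩⟩
instance : Neg FormalSeries := ⟨fun f => ⟨fun w => -f w⟩⟩
instance : Sub FormalSeries := ⟨fun f g => ⟨fun w => f w - g w⟩⟩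
instance : SMul ℂ FormalSeries := ⟨fun c f => ⟨fun w => c * f w⟩⟩
instance : SMul ℕ FormalSeries := ⟨fun n f => ⟨fun w => n • f w⟩⟩
instance : SMul ℤ FormalSeries := ⟨fun n f => ⟨fun w => n • f w⟩⟩

instance : AddCommGroup FormalSeries :=
  coeff_injective.addCommGroup coeff rfl (fun _ _ => rfl) (fun _ => rfl) (fun _ _ => rfl)
    (fun _ _ => rfl) (fun _ _ => rfl)

instance : Module ℂ FormalSeries :=
  coeff_injective.module ℂ ⟨⟨coeff, rfl⟩, fun _ _ => rfl⟩ fun _ _ => rfl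

/-- The weakest topology making all coefficients continuous. -/
instance : TopologicalSpace FormalSeries := TopologicalSpace.induced coeff inferInstance

theorem isEmbedding_coeff : Topology.IsEmbedding coeff := ⟨⟨rfl⟩, coeff_injective⟩

instance : T2Space FormalSeries := isEmbedding_coeff.t2Space

@[simp] theorem add_apply (f g : FormalSeries) (w : List ℕ+) : (f + g) w = f w + g w := rfl
@[simp] theorem sub_apply (f g : FormalSeries) (w : List ℕ+) : (f - g) w = f w - g w := rfl
@[simp] theorem neg_apply (f : FormalSeries) (w : List ℕ+) : (-f) w = -f w := rfl
@[simp] theorem zero_apply (w : List ℕ+) : (0 : FormalSeries) w = 0 := rfl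
@[simp] theorem smul_apply (c : ℂ) (f : FormalSeries) (w : List ℕ+) : (c • f) w = c * f w := rfl

/-- The unit `I`. -/
instance : One FormalSeries := ⟨⟨fun w => if w = [] then 1 else 0⟩⟩

/-- Multiplication of series: the coefficient of a word in a product is the sum over all ways
of splitting the word in two. -/
instance : Mul FormalSeries :=
  ⟨fun f g => ⟨fun w => ∑ j ∈ Finset.range (w.length + 1), f (w.take j) * g (w.drop j)⟩⟩

theorem mul_apply (f g : FormalSeries) (w : List ℕ+) :
    (f * g) w = ∑ j ∈ Finset.range (w.length + 1), f (w.take j) * g (w.drop j) := rfl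

theorem one_apply (w : List ℕ+) : (1 : FormalSeries) w = if w = [] then 1 else 0 := rfl

@[simp] theorem one_nil : (1 : FormalSeries) [] = 1 := rfl
@[simp] theorem one_cons (i : ℕ+) (w : List ℕ+) : (1 : FormalSeries) (i :: w) = 0 := rfl

/-- The series `∂ᵢ f` whose coefficient at `w` is the coefficient of `f` at `i w`. -/
def leftDeriv (i : ℕ+) (f : FormalSeries) : FormalSeries := ⟨fun w => f (i :: w)⟩

@[simp] theorem leftDeriv_apply (i : ℕ+) (f : FormalSeries) (w : List ℕ+) :
    leftDeriv i f w = f (i :: w) := rfl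

@[simp] theorem mul_nil (f g : FormalSeries) : (f * g) [] = f [] * g [] := by
  simp [mul_apply]

theorem mul_cons (f g : FormalSeries) (i : ℕ+) (w : List ℕ+) :
    (f * g) (i :: w) = f [] * g (i :: w) + (leftDeriv i f * g) w := by
  rw [mul_apply, mul_apply, List.length_cons, Finset.sum_range_succ']
  simp [add_comm]

theorem add_mul' (f g h : FormalSeries) : (f + g) * h = f * h + g * h := by
  ext w; simp [mul_apply, add_mul, Finset.sum_add_distrib]

theorem mul_add' (f g h : FormalSeries) : f * (g + h) = f * g + f * h := by
  ext w; simp [mul_apply, mul_add, Finset.sum_add_distrib]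

theorem smul_mul' (c : ℂ) (f g : FormalSeries) : (c • f) * g = c • (f * g) := by
  ext w; simp [mul_apply, Finset.mul_sum, mul_assoc]

theorem mul_smul' (c : ℂ) (f g : FormalSeries) : f * (c • g) = c • (f * g) := by
  ext w; simp [mul_apply, Finset.mul_sum, mul_left_comm]

theorem zero_mul' (f : FormalSeries) : 0 * f = 0 := by
  ext w; simp [mul_apply]

theorem mul_zero' (f : FormalSeries) : f * 0 = 0 := by
  ext w; simp [mul_apply]

theorem one_mul' (f : FormalSeries) : 1 * f = f := by
  ext w
  cases w with
  | nil => simp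
  | cons i w =>
    have : leftDeriv i 1 = 0 := by ext w; simp
    rw [mul_cons, this, zero_mul']; simp

theorem mul_one' (f : FormalSeries) : f * 1 = f := by
  ext w
  induction w generalizing f with
  | nil => simp
  | cons i w ih => rw [mul_cons, ih]; simp

theorem mul_assoc' (f g h : FormalSeries) : f * g * h = f * (g * h) := by
  ext w
  induction w generalizing f g with
  | nil => simp [mul_assoc]
  | cons i w ih =>
    have : leftDeriv i (f * g) = f [] • leftDeriv i g + leftDeriv i f * g := by
      ext v; simp [mul_cons]
    rw [mul_cons, mul_cons, mul_cons, this, add_mul', smul_mul', add_apply, ih]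
    simp only [smul_apply, mul_nil]
    ring

instance : Ring FormalSeries where
  __ := (inferInstance : AddCommGroup FormalSeries)
  left_distrib := mul_add'
  right_distrib := add_mul'
  zero_mul := zero_mul'
  mul_zero := mul_zero'
  mul_assoc := mul_assoc'
  one_mul := one_mul'
  mul_one := mul_one'

instance : Algebra ℂ FormalSeries := Algebra.ofModule smul_mul' mul_smul'

/-- The commutator bracket `⁅f, g⁆ = f g - g f`. -/
instance : LieRing FormalSeries := LieRing.ofAssociativeRing

instance : LieAlgebra ℂ FormalSeries := LieAlgebra.ofAssociativeAlgebra

theorem continuous_coeff (w : List ℕ+) : Continuous (fun f : FormalSeries => f w) :=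
  (continuous_apply w).comp isEmbedding_coeff.continuous

theorem continuous_of_coeff {α : Type*} [TopologicalSpace α] {F : α → FormalSeries}
    (h : ∀ w, Continuous fun x => F x w) : Continuous F :=
  isEmbedding_coeff.continuous_iff.2 (continuous_pi h)

instance : IsTopologicalRing FormalSeries where
  continuous_add := continuous_of_coeff fun w =>
    ((continuous_coeff w).comp continuous_fst).add ((continuous_coeff w).comp continuous_snd)
  continuous_mul := continuous_of_coeff fun w => by
    simp only [mul_apply]
    exact continuous_finsetSum _ fun j _ =>
      ((continuous_coeff _).comp continuous_fst).mul ((continuous_coeff _).comp continuous_snd)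
  continuous_neg := continuous_of_coeff fun w => (continuous_coeff w).neg

@[simp] theorem sum_apply {ι : Type*} (s : Finset ι) (F : ι → FormalSeries) (w : List ℕ+) :
    (∑ i ∈ s, F i) w = ∑ i ∈ s, F i w := by
  classical
  induction s using Finset.induction_on with
  | empty => simp
  | insert a s ha ih => rw [Finset.sum_insert ha, Finset.sum_insert ha, add_apply, ih]

theorem pow_apply_eq_zero {h : FormalSeries} (h0 : h [] = 0) (k : ℕ) (w : List ℕ+)
    (hw : w.length < k) : (h ^ k) w = 0 := by
  induction k generalizing w with
  | zero => simp at hw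
  | succ k ih =>
    rw [pow_succ, mul_apply]
    refine Finset.sum_eq_zero fun j hj => ?_
    by_cases hj' : j < k
    · rw [ih _ (by simp; omega), zero_mul]
    · have : j = w.length := by simp at hj; omega
      rw [this]; simp [h0]

/-- A power series in a series without constant term converges, coefficientwise. -/
theorem hasSum_pow {h : FormalSeries} (h0 : h [] = 0) (c : ℕ → ℂ) :
    HasSum (fun k => c k • h ^ k)
      ⟨fun w => ∑ k ∈ Finset.range (w.length + 1), c k * (h ^ k) w⟩ := by
  let φ : FormalSeries →+ (List ℕ+ → ℂ) := ⟨⟨coeff, rfl⟩, fun _ _ => rfl⟩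
  have hφ : Topology.IsInducing φ := isEmbedding_coeff.isInducing
  refine (hφ.hasSum_iff _ _).1 (Pi.hasSum.2 fun w => ?_)
  change HasSum (fun k => c k * (h ^ k) w) _
  refine hasSum_sum_of_ne_finset_zero (L := SummationFilter.unconditional ℕ)
    (s := Finset.range (w.length + 1)) (f := fun k => c k * (h ^ k) w) fun k hk => ?_
  rw [pow_apply_eq_zero h0 k w (by simpa using hk), mul_zero]

/-- `exp f = ∑ fⁿ / n!`. -/
def exp (f : FormalSeries) : FormalSeries := ∑' k : ℕ, ((k.factorial : ℂ)⁻¹) • f ^ k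

theorem exp_apply {f : FormalSeries} (h0 : f [] = 0) (w : List ℕ+) :
    exp f w = ∑ k ∈ Finset.range (w.length + 1), ((k.factorial : ℂ)⁻¹) * (f ^ k) w :=
  congrFun (congrArg coeff (hasSum_pow h0 _).tsum_eq) w

theorem exp_nil {f : FormalSeries} (h0 : f [] = 0) : exp f [] = 1 := by
  rw [exp_apply h0]; simp

/-- `log f = - ∑_{n ≥ 1} (I - f)ⁿ / n`. -/
def log (f : FormalSeries) : FormalSeries := -∑' n : ℕ, (((n : ℂ) + 1)⁻¹) • (1 - f) ^ (n + 1)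

/-- The variable `X_i` (that is, `X_i tⁱ`). -/
def X (i : ℕ+) : FormalSeries := ⟨fun w => if w = [i] then 1 else 0⟩

/-- The weight `i₁ + ⋯ + iₖ` of the monomial `X_{i₁} ⋯ X_{iₖ}`. -/
def weight (w : List ℕ+) : ℕ := (w.map PNat.val).sum

/-- The part `gₙ tⁿ` of a series `g = ∑ gₙ tⁿ`. -/
def component (n : ℕ) (f : FormalSeries) : FormalSeries := 
  ⟨fun w => if weight w = n then f w else 0⟩

theorem component_apply (n : ℕ) (f : FormalSeries) (w : List ℕ+) :
    component n f w = if weight w = n then f w else 0 := rfl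

/-- The free Lie algebra generated by `X₁, …, Xₙ`, inside the free associative algebra. -/
def freeLie (n : ℕ) : LieSubalgebra ℂ FormalSeries :=
  LieSubalgebra.lieSpan ℂ FormalSeries {f | ∃ i : ℕ+, (i : ℕ) ≤ n ∧ f = X i}

theorem freeLie_mono {m n : ℕ} (h : m ≤ n) : freeLie m ≤ freeLie n :=
  LieSubalgebra.lieSpan_mono (by rintro f ⟨i, hi, rfl⟩; exact ⟨i, hi.trans h, rfl⟩)

theorem weight_take_add_drop (w : List ℕ+) (j : ℕ) :
    weight (w.take j) + weight (w.drop j) = weight w := by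
  conv_rhs => rw [← List.take_append_drop j w]
  simp only [weight, List.map_append, List.sum_append]

theorem component_mul (n : ℕ) (f g : FormalSeries) :
    component n (f * g) =
      ∑ p ∈ Finset.HasAntidiagonal.antidiagonal n, component p.1 f * component p.2 g := by
  ext w
  simp only [sum_apply, mul_apply, component_apply]
  rw [Finset.sum_comm]
  split_ifs with hw
  · refine Finset.sum_congr rfl fun j _ => ?_
    rw [Finset.sum_eq_single (weight (w.take j), weight (w.drop j))]
    · simp
    · rintro ⟨p, q⟩ _ hpq
      by_cases h1 : weight (w.take j) = p
      · by_cases h2 : weight (w.drop j) = q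
        · simp [h1, h2] at hpq
        · simp [h2]
      · simp [h1]
    · intro h
      simp [weight_take_add_drop, hw] at h
  · refine (Finset.sum_eq_zero fun j _ => Finset.sum_eq_zero ?_).symm
    rintro ⟨p, q⟩ hpq
    have := weight_take_add_drop w j
    rw [Finset.HasAntidiagonal.mem_antidiagonal] at hpq
    by_cases h1 : weight (w.take j) = p
    · by_cases h2 : weight (w.drop j) = q
      · omega
      · simp [h2]
    · simp [h1]

theorem component_add (n : ℕ) (f g : FormalSeries) :
    component n (f + g) = component n f + component n g := by
  ext w; simp only [component_apply, add_apply]; split_ifs <;> simp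

theorem component_smul (n : ℕ) (c : ℂ) (f : FormalSeries) :
    component n (c • f) = c • component n f := by
  ext w; simp only [component_apply, smul_apply]; split_ifs <;> simp

theorem component_zero (n : ℕ) : component n 0 = 0 := by
  ext w; simp [component_apply]

theorem component_lie (n : ℕ) (f g : FormalSeries) :
    component n ⁅f, g⁆ =
      ∑ p ∈ Finset.HasAntidiagonal.antidiagonal n, ⁅component p.1 f, component p.2 g⁆ := by
  have hsub : component n (f * g - g * f) = component n (f * g) - component n (g * f) := by
    ext w; simp only [component_apply, sub_apply]; split_ifs <;> simp
  simp only [Ring.lie_def, hsub, Finset.sum_sub_distrib]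
  rw [component_mul, component_mul n g f, ← Finset.Nat.sum_antidiagonal_swap (f := fun p => component p.1 g * component p.2 f)]
  rfl

end FormalSeries

/-- `ℒ_Lie`: the Lie algebra of Lie elements, i.e. the series `g = ∑_{n ≥ 1} gₙ tⁿ` without
constant term such that every `gₙ` belongs to the free Lie algebra generated by `X₁, …, Xₙ`.
The bracket is the commutator `⁅f, g⁆ = f g - g f`. -/
def lieElements : LieSubalgebra ℂ FormalSeries where
  carrier := {g | g [] = 0 ∧ ∀ n : ℕ, 1 ≤ n → FormalSeries.component n g ∈ FormalSeries.freeLie n}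
  zero_mem' := ⟨rfl, fun n _ => by rw [FormalSeries.component_zero]; exact zero_mem _⟩
  add_mem' := by
    rintro f g ⟨f0, hf⟩ ⟨g0, hg⟩
    refine ⟨by simp [f0, g0], fun n hn => ?_⟩
    rw [FormalSeries.component_add]
    exact add_mem (hf n hn) (hg n hn)
  smul_mem' := by
    rintro c f ⟨f0, hf⟩
    refine ⟨by simp [f0], fun n hn => ?_⟩
    rw [FormalSeries.component_smul]
    exact (FormalSeries.freeLie n).smul_mem c (hf n hn)
  lie_mem' := by
    rintro f g ⟨f0, hf⟩ ⟨g0, hg⟩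
    have key : ∀ {h : FormalSeries}, h [] = 0 →
        (∀ n : ℕ, 1 ≤ n → FormalSeries.component n h ∈ FormalSeries.freeLie n) →
        ∀ m n : ℕ, m ≤ n → FormalSeries.component m h ∈ FormalSeries.freeLie n := by
      intro h h0 hh m n hmn
      rcases Nat.eq_zero_or_pos m with rfl | hm
      · have : FormalSeries.component 0 h = 0 := by
          ext w
          cases w with
          | nil => simp [FormalSeries.component_apply, h0]
          | cons i w => simp [FormalSeries.component_apply, FormalSeries.weight]
        rw [this]; exact zero_mem _
      · exact FormalSeries.freeLie_mono hmn (hh m hm)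
    refine ⟨by simp [Ring.lie_def, f0, g0], fun n hn => ?_⟩
    rw [FormalSeries.component_lie]
    refine sum_mem fun p hp => ?_
    have := Finset.HasAntidiagonal.mem_antidiagonal.1 hp
    exact LieSubalgebra.lie_mem _ (key f0 hf _ _ (by omega)) (key g0 hg _ _ (by omega))

/-- `G`: the group of series with constant term `1`, with the topology induced from `𝒜`. -/
structure UnitSeries : Type where
  /-- The underlying series. -/
  val : FormalSeries
  nil : val [] = 1

namespace UnitSeries

instance : CoeOut UnitSeries FormalSeries := ⟨val⟩
instance : TopologicalSpace UnitSeries := TopologicalSpace.induced val inferInstance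

theorem val_injective : Function.Injective val := fun ⟨_, _⟩ ⟨_, _⟩ h => by
  cases h; rfl

theorem isEmbedding_val : Topology.IsEmbedding val := ⟨⟨rfl⟩, val_injective⟩

theorem ext {f g : UnitSeries} (h : ∀ w, (f : FormalSeries) w = (g : FormalSeries) w) : f = g :=
  val_injective (FormalSeries.ext h)

instance : One UnitSeries := ⟨⟨1, rfl⟩⟩
instance : Mul UnitSeries := ⟨fun f g => ⟨f.val * g.val, by simp [f.nil, g.nil]⟩⟩

/-- The inverse of `f`, by the geometric series `∑ (1 - f)ᵏ`. -/
instance : Inv UnitSeries :=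
  ⟨fun f => ⟨⟨fun w => ∑ k ∈ Finset.range (w.length + 1), ((1 - f.val) ^ k) w⟩, by simp⟩⟩

@[simp] theorem coe_one : ((1 : UnitSeries) : FormalSeries) = 1 := rfl
@[simp] theorem coe_mul (f g : UnitSeries) : ((f * g : UnitSeries) : FormalSeries) = f * g := rfl
@[simp] theorem coe_nil (f : UnitSeries) : (f : FormalSeries) [] = 1 := f.nil

theorem coe_inv_apply (f : UnitSeries) (w : List ℕ+) (N : ℕ) (hN : w.length < N) :
    ((f⁻¹ : UnitSeries) : FormalSeries) w
      = ∑ k ∈ Finset.range N, ((1 - (f : FormalSeries)) ^ k) w := by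
  refine Finset.sum_subset (s₁ := Finset.range (w.length + 1))
    (f := fun k => ((1 - (f : FormalSeries)) ^ k) w) (fun k => ?_) fun k _ hk => ?_
  · simp only [Finset.mem_range]; omega
  · exact FormalSeries.pow_apply_eq_zero (by simp) k w (by simpa using hk)

theorem inv_mul' (f : UnitSeries) : f⁻¹ * f = 1 := by
  refine ext fun w => ?_
  have h : ((f⁻¹ * f : UnitSeries) : FormalSeries) w =
      ((∑ k ∈ Finset.range (w.length + 1), (1 - (f : FormalSeries)) ^ k) * f) w := by
    rw [coe_mul, FormalSeries.mul_apply, FormalSeries.mul_apply]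
    refine Finset.sum_congr rfl fun j hj => ?_
    rw [coe_inv_apply f _ (w.length + 1) (by simp), FormalSeries.sum_apply]
  have h2 := geom_sum_mul_neg (1 - (f : FormalSeries)) (w.length + 1)
  rw [sub_sub_cancel] at h2
  rw [h, h2, FormalSeries.sub_apply, FormalSeries.pow_apply_eq_zero (by simp) _ _ (by simp)]
  simp

instance : Group UnitSeries where
  mul_assoc f g h := val_injective (mul_assoc _ _ _)
  one_mul f := val_injective (one_mul _)
  mul_one f := val_injective (mul_one _)
  inv_mul_cancel := inv_mul'

instance : IsTopologicalGroup UnitSeries where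
  continuous_mul := isEmbedding_val.continuous_iff.2
    ((isEmbedding_val.continuous.comp continuous_fst).mul
      (isEmbedding_val.continuous.comp continuous_snd))
  continuous_inv := isEmbedding_val.continuous_iff.2 (FormalSeries.continuous_of_coeff fun w =>
    continuous_finsetSum (Finset.range (w.length + 1)) fun k _ =>
      (FormalSeries.continuous_coeff w).comp
        ((continuous_const.sub isEmbedding_val.continuous).pow k))

end UnitSeries

/-- `X`: the sequences `a = (a₁, a₂, …)` of bounded measurable complex functions on `[0, T]`
with `sup_{x, i} |a_i(x)|^{1/i} < ∞`. The functions are defined on `ℝ`, but their values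
outside `[0, T]` play no role. -/
structure PathCoeff (T : ℝ) where
  toFun : ℕ+ → ℝ → ℂ
  measurable : ∀ i, Measurable (toFun i)
  bounded : ∃ C : ℝ, ∀ i, ∀ x ∈ Set.Icc 0 T, ‖toFun i x‖ ≤ C ^ (i : ℕ)

namespace PathCoeff

variable {T : ℝ}

/-- The iterated integral
`∫_{x ≥ s₁ ≥ ⋯ ≥ sₖ ≥ 0} a_{i₁}(s₁) ⋯ a_{iₖ}(sₖ) dsₖ ⋯ ds₁` over `[0, x]`. -/
def iteratedIntegral (a : PathCoeff T) : List ℕ+ → ℝ → ℂ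
  | [], _ => 1
  | i :: w, x => ∫ s in (0 : ℝ)..x, a.toFun i s * iteratedIntegral a w s

/-- The solution `F_a : [0, T] → G` of `F' = (∑ a_i(x) tⁱ X_i) F`, `F(0) = I`, obtained by Picard
iteration: the coefficient of `X_{i₁} ⋯ X_{iₖ}` is the iterated integral with index
`i₁, …, iₖ`. -/
def solution (a : PathCoeff T) (x : ℝ) : UnitSeries :=
  ⟨⟨fun w => a.iteratedIntegral w x⟩, rfl⟩

/-- `E(a) = F_a(T)`. -/
def E (a : PathCoeff T) : UnitSeries := a.solution T

theorem solution_apply (a : PathCoeff T) (x : ℝ) (w : List ℕ+) :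
    (a.solution x : FormalSeries) w = a.iteratedIntegral w x := rfl

theorem intervalIntegrable (a : PathCoeff T) (i : ℕ+) {x y : ℝ} (hx : x ∈ Set.Icc 0 T)
    (hy : y ∈ Set.Icc 0 T) : IntervalIntegrable (a.toFun i) MeasureTheory.volume x y := by
  obtain ⟨C, hC⟩ := a.bounded
  have hsub : Set.uIcc x y ⊆ Set.Icc 0 T := Set.uIcc_subset_Icc hx hy
  rw [intervalIntegrable_iff]
  refine MeasureTheory.Measure.integrableOn_of_bounded (M := C ^ (i : ℕ)) (by simp)
    (a.measurable i).aestronglyMeasurable ?_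
  refine (MeasureTheory.ae_restrict_iff' measurableSet_uIoc).2 (Filter.Eventually.of_forall ?_)
  exact fun s hs => hC i s (hsub (Set.uIoc_subset_uIcc hs))

theorem continuousOn_iteratedIntegral (hT : 0 ≤ T) (a : PathCoeff T) (w : List ℕ+) :
    ContinuousOn (a.iteratedIntegral w) (Set.Icc 0 T) := by
  have h0 : (0 : ℝ) ∈ Set.Icc 0 T := ⟨le_rfl, hT⟩
  have hT' : T ∈ Set.Icc 0 T := ⟨hT, le_rfl⟩
  induction w with
  | nil => exact continuousOn_const
  | cons i w ih =>
    have hI : IntervalIntegrable (fun s => a.toFun i s * a.iteratedIntegral w s)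
        MeasureTheory.volume 0 T :=
      (a.intervalIntegrable i h0 hT').mul_continuousOn (by rwa [Set.uIcc_of_le hT])
    have := intervalIntegral.continuousOn_primitive_interval' hI Set.left_mem_uIcc
    rwa [Set.uIcc_of_le hT] at this

theorem intervalIntegrable_mul (hT : 0 ≤ T) (a : PathCoeff T) (i : ℕ+) (w : List ℕ+) {x y : ℝ}
    (hx : x ∈ Set.Icc 0 T) (hy : y ∈ Set.Icc 0 T) :
    IntervalIntegrable (fun s => a.toFun i s * a.iteratedIntegral w s)
      MeasureTheory.volume x y :=
  (a.intervalIntegrable i hx hy).mul_continuousOn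
    ((a.continuousOn_iteratedIntegral hT w).mono (Set.uIcc_subset_Icc hx hy))

theorem exists_bound (a : PathCoeff T) :
    ∃ C : ℝ, 0 ≤ C ∧ ∀ i, ∀ x ∈ Set.Icc 0 T, ‖a.toFun i x‖ ≤ C ^ (i : ℕ) := by
  obtain ⟨C, hC⟩ := a.bounded
  exact ⟨|C|, abs_nonneg C, fun i x hx => (hC i x hx).trans
    ((le_abs_self _).trans_eq (abs_pow C i))⟩

/-- The product `a * b`: first run through `b`, then through `a`, at double speed. -/
def concat (a b : PathCoeff T) : PathCoeff T where
  toFun i x := if x ≤ T / 2 then 2 * b.toFun i (2 * x) else 2 * a.toFun i (2 * x - T)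
  measurable i := Measurable.ite measurableSet_Iic
    (((b.measurable i).comp (by fun_prop)).const_mul 2)
    (((a.measurable i).comp (by fun_prop)).const_mul 2)
  bounded := by
    obtain ⟨A, hA0, hA⟩ := a.exists_bound
    obtain ⟨B, hB0, hB⟩ := b.exists_bound
    refine ⟨2 * max A B, fun i x hx => ?_⟩
    have h2 : (2 : ℝ) ≤ 2 ^ (i : ℕ) := le_self_pow₀ (by norm_num) i.ne_zero
    have hm : 0 ≤ max A B := le_max_of_le_left hA0
    have main : ∀ z : ℂ, ‖z‖ ≤ max A B ^ (i : ℕ) → ‖2 * z‖ ≤ (2 * max A B) ^ (i : ℕ) := by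
      intro z hz
      rw [norm_mul, mul_pow, Complex.norm_ofNat]
      gcongr
    split_ifs with h
    · refine main _ ((hB i _ ⟨by linarith [hx.1], by linarith⟩).trans ?_)
      gcongr; exact le_max_right _ _
    · push Not at h
      refine main _ ((hA i _ ⟨by linarith, by linarith [hx.2]⟩).trans ?_)
      gcongr; exact le_max_left _ _

/-- The inverse path `a⁻¹(x) = -a(T - x)`. -/
def reverse (a : PathCoeff T) : PathCoeff T where
  toFun i x := -a.toFun i (T - x)
  measurable i := ((a.measurable i).comp (by fun_prop)).neg
  bounded := by
    obtain ⟨C, hC⟩ := a.bounded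
    refine ⟨C, fun i x hx => ?_⟩
    rw [norm_neg]
    exact hC i _ ⟨by linarith [hx.2], by linarith [hx.1]⟩

theorem concat_first (a b : PathCoeff T) (w : List ℕ+) (x : ℝ)
    (hx : x ∈ Set.Icc 0 (T / 2)) :
    (a.concat b).iteratedIntegral w x = b.iteratedIntegral w (2 * x) := by
  induction w generalizing x with
  | nil => rfl
  | cons i w ih =>
    have h1 : (a.concat b).iteratedIntegral (i :: w) x =
        ∫ s in (0 : ℝ)..x, 2 * (b.toFun i (2 * s) * b.iteratedIntegral w (2 * s)) := by
      refine intervalIntegral.integral_congr fun s hs => ?_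
      rw [Set.uIcc_of_le hx.1] at hs
      have hs' : s ≤ T / 2 := hs.2.trans hx.2
      simp only [concat, if_pos hs']
      rw [← concat, ih s ⟨hs.1, hs'⟩, mul_assoc]
    have h2 := intervalIntegral.smul_integral_comp_mul_left (a := 0) (b := x)
      (fun s => b.toFun i s * b.iteratedIntegral w s) 2
    rw [h1, intervalIntegral.integral_const_mul]
    simpa [iteratedIntegral] using h2

theorem concat_second (hT : 0 ≤ T) (a b : PathCoeff T) (w : List ℕ+) (x : ℝ)
    (hx : x ∈ Set.Icc (T / 2) T) :
    (a.concat b).iteratedIntegral w x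
      = ((a.solution (2 * x - T) : FormalSeries) * b.solution T) w := by
  induction w generalizing x with
  | nil => simp [iteratedIntegral]
  | cons i w ih =>
    have hm : T / 2 ∈ Set.Icc 0 T := ⟨by linarith, by linarith⟩
    have hx' : x ∈ Set.Icc 0 T := ⟨by linarith [hx.1], hx.2⟩
    have h1 : (a.concat b).iteratedIntegral (i :: w) x =
        (a.concat b).iteratedIntegral (i :: w) (T / 2) +
        ∫ s in (T / 2)..x, (a.concat b).toFun i s * (a.concat b).iteratedIntegral w s :=
      (intervalIntegral.integral_add_adjacent_intervals
        (intervalIntegrable_mul hT _ i w ⟨le_rfl, hT⟩ hm)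
        (intervalIntegrable_mul hT _ i w hm hx')).symm
    have h2 : (∫ s in (T / 2)..x, (a.concat b).toFun i s * (a.concat b).iteratedIntegral w s) =
        ∫ s in (T / 2)..x, ∑ j ∈ Finset.range (w.length + 1),
          b.iteratedIntegral (w.drop j) T *
            (2 * (a.toFun i (2 * s - T) * a.iteratedIntegral (w.take j) (2 * s - T))) := by
      refine intervalIntegral.integral_congr_ae (Filter.Eventually.of_forall fun s hs => ?_)
      rw [Set.uIoc_of_le hx.1] at hs
      rw [ih s ⟨hs.1.le, hs.2.trans hx.2⟩, FormalSeries.mul_apply, Finset.mul_sum]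
      refine Finset.sum_congr rfl fun j _ => ?_
      simp only [concat, if_neg (not_le.2 hs.1), solution_apply]
      ring
    have h3 : ∀ v : List ℕ+, (∫ s in (T / 2)..x,
        2 * (a.toFun i (2 * s - T) * a.iteratedIntegral v (2 * s - T))) =
        a.iteratedIntegral (i :: v) (2 * x - T) := by
      intro v
      have := intervalIntegral.smul_integral_comp_mul_sub (a := T / 2) (b := x)
        (fun s => a.toFun i s * a.iteratedIntegral v s) 2 T
      rw [intervalIntegral.integral_const_mul]
      have e : 2 * (T / 2) - T = 0 := by ring
      rw [e] at this
      simpa [iteratedIntegral] using this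
    have hint : ∀ v : List ℕ+, IntervalIntegrable (fun s =>
        2 * (a.toFun i (2 * s - T) * a.iteratedIntegral v (2 * s - T)))
        MeasureTheory.volume (T / 2) x := by
      intro v
      have h := intervalIntegrable_mul hT a i v (x := 0) (y := 2 * x - T) ⟨le_rfl, hT⟩
        ⟨by linarith [hx.1], by linarith [hx.2]⟩
      have h' := (h.comp_sub_right T).comp_mul_left (c := 2)
      refine (IntervalIntegrable.const_mul ?_ 2)
      convert h' using 1 <;> ring
    rw [h1, concat_first a b _ _ ⟨hm.1, le_rfl⟩, h2,
      intervalIntegral.integral_finsetSum fun j _ => (hint _).const_mul _,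
      FormalSeries.mul_cons, FormalSeries.mul_apply]
    congr 1
    · rw [UnitSeries.coe_nil, one_mul, solution_apply]
      congr 1; ring
    · refine Finset.sum_congr rfl fun j _ => ?_
      rw [intervalIntegral.integral_const_mul, h3, mul_comm]
      rfl

/-- `E(a * b) = E(a) E(b)`. -/
theorem E_concat (hT : 0 ≤ T) (a b : PathCoeff T) : (a.concat b).E = a.E * b.E := by
  refine UnitSeries.ext fun w => ?_
  have := concat_second hT a b w T ⟨by linarith, le_rfl⟩
  rw [show 2 * T - T = T by ring] at this
  exact this

theorem reverse_aux (hT : 0 ≤ T) (a : PathCoeff T) (w : List ℕ+) (x : ℝ)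
    (hx : x ∈ Set.Icc 0 T) :
    a.reverse.iteratedIntegral w x
      = ((a.solution (T - x) : FormalSeries) * ((a.E)⁻¹ : UnitSeries)) w := by
  induction w generalizing x with
  | nil => simp [iteratedIntegral]
  | cons i w ih =>
    have h1 : a.reverse.iteratedIntegral (i :: w) x =
        ∫ s in (0 : ℝ)..x, ∑ j ∈ Finset.range (w.length + 1),
          (-((a.E)⁻¹ : UnitSeries).1 (w.drop j)) *
            (a.toFun i (T - s) * a.iteratedIntegral (w.take j) (T - s)) := by
      refine intervalIntegral.integral_congr fun s hs => ?_
      rw [Set.uIcc_of_le hx.1] at hs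
      rw [ih s ⟨hs.1, hs.2.trans hx.2⟩, FormalSeries.mul_apply, Finset.mul_sum]
      refine Finset.sum_congr rfl fun j _ => ?_
      simp only [reverse, solution_apply]
      ring
    have hxT : T - x ∈ Set.Icc 0 T := ⟨by linarith [hx.2], by linarith [hx.1]⟩
    have h3 : ∀ v : List ℕ+, (∫ s in (0 : ℝ)..x,
        a.toFun i (T - s) * a.iteratedIntegral v (T - s)) =
        a.iteratedIntegral (i :: v) T - a.iteratedIntegral (i :: v) (T - x) := by
      intro v
      have e := intervalIntegral.integral_comp_sub_left (a := 0) (b := x)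
        (fun s => a.toFun i s * a.iteratedIntegral v s) T
      rw [e, sub_zero]
      exact (intervalIntegral.integral_interval_sub_left
        (intervalIntegrable_mul hT a i v ⟨le_rfl, hT⟩ ⟨hT, le_rfl⟩)
        (intervalIntegrable_mul hT a i v ⟨le_rfl, hT⟩ hxT)).symm
    have hint : ∀ v : List ℕ+, IntervalIntegrable (fun s =>
        a.toFun i (T - s) * a.iteratedIntegral v (T - s)) MeasureTheory.volume 0 x := by
      intro v
      have h := (intervalIntegrable_mul hT a i v (x := T) (y := T - x)
        ⟨hT, le_rfl⟩ hxT).comp_sub_left T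
      simpa using h
    have h4 : ((a.E : FormalSeries) * ((a.E)⁻¹ : UnitSeries)) (i :: w) = 0 := by
      rw [← UnitSeries.coe_mul, mul_inv_cancel]; rfl
    rw [FormalSeries.mul_cons, UnitSeries.coe_nil, one_mul, FormalSeries.mul_apply] at h4
    rw [h1, intervalIntegral.integral_finsetSum fun j _ => (hint _).const_mul _,
      FormalSeries.mul_cons, UnitSeries.coe_nil, one_mul, eq_neg_of_add_eq_zero_left h4,
      FormalSeries.mul_apply, neg_add_eq_sub, ← Finset.sum_sub_distrib]
    refine Finset.sum_congr rfl fun j _ => ?_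
    rw [intervalIntegral.integral_const_mul, h3]
    simp only [FormalSeries.leftDeriv_apply, solution_apply, E]
    ring

/-- `E(a⁻¹) = E(a)⁻¹`. -/
theorem E_reverse (hT : 0 ≤ T) (a : PathCoeff T) : a.reverse.E = (a.E)⁻¹ := by
  refine UnitSeries.ext fun w => ?_
  have h := reverse_aux hT a w T ⟨hT, le_rfl⟩
  have h0 : a.solution 0 = 1 := by
    refine UnitSeries.ext fun v => ?_
    cases v with
    | nil => rfl
    | cons i v =>
      rw [solution_apply]
      simp [iteratedIntegral]
  rw [sub_self, h0, UnitSeries.coe_one, one_mul] at h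
  exact h

end PathCoeff

/-- The group of paths `G(X)`, identified with its image under `E` in `G`. -/
def pathGroup {T : ℝ} (hT : 0 < T) : Subgroup UnitSeries where
  carrier := Set.range (PathCoeff.E (T := T))
  mul_mem' := by
    rintro _ _ ⟨a, rfl⟩ ⟨b, rfl⟩
    exact ⟨a.concat b, a.E_concat hT.le b⟩
  one_mem' := by
    let a : PathCoeff T := ⟨fun _ _ => 0, fun _ => measurable_const, 0, fun i x _ => by simp⟩
    exact ⟨a.concat a.reverse, by
      rw [a.E_concat hT.le, a.E_reverse hT.le, mul_inv_cancel]⟩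
  inv_mem' := by
    rintro _ ⟨a, rfl⟩
    exact ⟨a.reverse, a.E_reverse hT.le⟩

/-- The group of formal paths `G_f(X)`: the completion of `G(X)`, identified with the
closure of (the image of) `G(X)` in `G`. -/
def formalPathGroup {T : ℝ} (hT : 0 < T) : Subgroup UnitSeries := (pathGroup hT).topologicalClosure

/-- The exponential map on `ℒ_Lie`. -/
def lieExp (r : lieElements) : UnitSeries :=
  ⟨FormalSeries.exp (r : FormalSeries), FormalSeries.exp_nil r.2.1⟩

/-- `A_R`: the minimal closed Lie subalgebra of `ℒ_Lie` containing `R`. -/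
def closedLieSpan (R : Set lieElements) : LieSubalgebra ℂ lieElements :=
  sInf {A | IsClosed (A : Set lieElements) ∧ R ⊆ A}

/-- `H_R`: the subgroup generated by all `e^{c r}`, `r ∈ R`, `c ∈ ℂ`. -/
def expSubgroup (R : Set lieElements) : Subgroup UnitSeries :=
  Subgroup.closure {g | ∃ r ∈ R, ∃ c : ℂ, g = lieExp (c • r)}

/-- The closure of `H_R` in `G_f(X)`, as a subgroup of `G_f(X)`. -/
def closedExpSubgroup {T : ℝ} (hT : 0 < T) (R : Set lieElements) :
    Subgroup (formalPathGroup hT) :=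
  ((expSubgroup R).subgroupOf (formalPathGroup hT)).topologicalClosure

end

open Filter Topology

/-! ### The weight filtration and the topology. -/

namespace FormalSeries

/-! Let `filtration n` be the series of weight at least `n`. Only finitely many words have weight
below `n`, so a linear functional that kills `filtration n` is a finite combination of coefficients,
hence continuous; a subspace containing `filtration n` is therefore closed, and a closed subspace
`A` is the intersection of the `A ⊔ filtration n` (`mem_of_forall_mem_sup`). All analysis is thus
done coefficient by coefficient, modulo `filtration n`, with functionals separating a point from a
subspace.

The equality `log (closure of H_R) = A_R` has two halves. The set `e^{A_R}` is a closed group, by a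
Baker-Campbell-Hausdorff argument (`log_exp_mul_exp_mem`): `z(t) = log (e^a e^{tb})` solves a
differential equation built from `b` and brackets with `z`, and each bracket gains one weight, so
`z` lies in `A ⊔ filtration n` for every `n` by induction. It contains the generators of `H_R`,
hence the closure. Conversely, for a closed subgroup `K` the series `a` with `e^{ca} ∈ K` for all
complex `c` form a closed Lie algebra (`lieAlgebra`), by the product formula for sums and by
differentiating conjugation for brackets. For `K` the closure of `H_R` it contains `R`, hence `A_R`.
For `K` the group of formal paths it contains every `X_i`, hence all Lie elements, which gives `H_R
⊂ G_f(X)`.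

If the closure of `H_R` is normal, then `e^{sx} a e^{-sx}` stays in `A_R`, and its derivative at `0`
is `⁅x, a⁆`, so `A_R` is an ideal. If `A_R` is an ideal, conjugation by a path preserves it
(`conj_solution_mem`): along the solution, the increment of the conjugate is, to first order, a
bracket with a Lie element. By continuity this extends to the closure `G_f(X)`, and `log` commutes
with conjugation. -/

theorem weight_cons (i : ℕ+) (w : List ℕ+) : weight (i :: w) = i + weight w := by
  simp [weight]

theorem length_le_weight (w : List ℕ+) : w.length ≤ weight w := by
  induction w with
  | nil => simp
  | cons i w ih =>
    rw [weight_cons, List.length_cons]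
    have := i.pos
    omega

/-- Letters have weight at least one, so both the first letter and the weight of the tail are
bounded. This makes the quotients by the weight filtration finite-dimensional although the alphabet
is infinite. -/
theorem finite_weight_lt (n : ℕ) : {w : List ℕ+ | weight w < n}.Finite := by
  induction n with
  | zero => simp
  | succ n ih =>
    have hfin : {i : ℕ+ | (i : ℕ) ≤ n}.Finite :=
      (Set.finite_Iic n).preimage PNat.coe_injective.injOn
    refine ((Set.finite_singleton []).union (Set.Finite.image2 List.cons hfin ih)).subset ?_
    rintro (_ | ⟨i, w⟩) hw
    · exact Or.inl rfl
    · right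
      have h1 : (i : ℕ) + weight w < n + 1 := by rw [← weight_cons]; exact hw
      have := i.pos
      exact ⟨i, show (i : ℕ) ≤ n by omega, w, show weight w < n by omega, rfl⟩

/-- The series of weight at least `n`. -/
def filtration (n : ℕ) : Submodule ℂ FormalSeries where
  carrier := {f | ∀ w, weight w < n → f w = 0}
  zero_mem' := fun _ _ => rfl
  add_mem' := fun hf hg w hw => by rw [add_apply, hf w hw, hg w hw, add_zero]
  smul_mem' := fun c f hf w hw => by rw [smul_apply, hf w hw, mul_zero]

theorem filtration_anti {m n : ℕ} (h : m ≤ n) : filtration n ≤ filtration m :=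
  fun _ hf w hw => hf w (hw.trans_le h)

theorem mem_filtration_zero (f : FormalSeries) : f ∈ filtration 0 :=
  fun _ hw => absurd hw (Nat.not_lt_zero _)

theorem mem_filtration_one {f : FormalSeries} : f ∈ filtration 1 ↔ f [] = 0 := by
  refine ⟨fun h => h [] Nat.one_pos, fun h w hw => ?_⟩
  have := length_le_weight w
  obtain rfl : w = [] := List.eq_nil_of_length_eq_zero (by omega)
  exact h

theorem mul_mem_filtration {m n : ℕ} {f g : FormalSeries} (hf : f ∈ filtration m)
    (hg : g ∈ filtration n) : f * g ∈ filtration (m + n) := by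
  intro w hw
  rw [mul_apply]
  refine Finset.sum_eq_zero fun j _ => ?_
  have := weight_take_add_drop w j
  by_cases h : weight (w.take j) < m
  · rw [hf _ h, zero_mul]
  · rw [hg _ (by omega), mul_zero]

theorem mul_mem_filtration_left (g : FormalSeries) {n : ℕ} {f : FormalSeries}
    (hf : f ∈ filtration n) : g * f ∈ filtration n := by
  simpa using mul_mem_filtration (mem_filtration_zero g) hf

theorem mul_mem_filtration_right (g : FormalSeries) {n : ℕ} {f : FormalSeries}
    (hf : f ∈ filtration n) : f * g ∈ filtration n :=
  mul_mem_filtration hf (mem_filtration_zero g)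

theorem pow_mem_filtration {f : FormalSeries} (h0 : f [] = 0) (n : ℕ) :
    f ^ n ∈ filtration n := by
  induction n with
  | zero => exact mem_filtration_zero _
  | succ n ih => rw [pow_succ]; exact mul_mem_filtration ih (mem_filtration_one.2 h0)

theorem lie_mem_filtration {m n : ℕ} {f g : FormalSeries} (hf : f ∈ filtration m)
    (hg : g ∈ filtration n) : ⁅f, g⁆ ∈ filtration (m + n) := by
  rw [Ring.lie_def]
  exact sub_mem (mul_mem_filtration hf hg) (add_comm n m ▸ mul_mem_filtration hg hf)

theorem eq_of_forall_sub_mem {f g : FormalSeries} (h : ∀ n, f - g ∈ filtration n) : f = g := by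
  ext w
  exact sub_eq_zero.1 (h (weight w + 1) w (Nat.lt_succ_self _))

/-- A linear functional vanishing on all series of large weight is a finite combination of
coefficients. -/
theorem exists_sum_of_filtration_le_ker {n : ℕ} (φ : FormalSeries →ₗ[ℂ] ℂ)
    (hφ : ∀ f ∈ filtration n, φ f = 0) :
    ∃ (s : Finset (List ℕ+)) (c : List ℕ+ → ℂ), ∀ f, φ f = ∑ w ∈ s, c w * f w := by
  classical
  -- The coefficients are the values of `φ` on monomials; truncating `f` below weight `n` does not
  -- change `φ f`.
  refine ⟨(finite_weight_lt n).toFinset, fun w => φ ⟨fun v => if v = w then 1 else 0⟩,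
    fun f => ?_⟩
  have h : f - ∑ w ∈ (finite_weight_lt n).toFinset,
      f w • (⟨fun v => if v = w then 1 else 0⟩ : FormalSeries) ∈ filtration n := by
    intro v hv
    rw [sub_apply, sum_apply, Finset.sum_eq_single v]
    · simp
    · intro w _ hw; simp [hw.symm]
    · intro hv'; simp [hv] at hv'
  have h2 := hφ _ h
  rw [map_sub, sub_eq_zero, map_sum] at h2
  rw [h2]
  refine Finset.sum_congr rfl fun w _ => ?_
  rw [map_smul, smul_eq_mul, mul_comm]

/-- A submodule containing all series of large weight is cut out by finite combinations of
coefficients. -/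
theorem exists_functional {n : ℕ} {W : Submodule ℂ FormalSeries} (hW : filtration n ≤ W)
    {f : FormalSeries} (hf : f ∉ W) :
    ∃ φ : FormalSeries →ₗ[ℂ] ℂ, (∀ g ∈ W, φ g = 0) ∧ φ f ≠ 0 ∧
      ∃ (s : Finset (List ℕ+)) (c : List ℕ+ → ℂ), ∀ f, φ f = ∑ w ∈ s, c w * f w := by
  obtain ⟨φ, hφ, hW'⟩ := Submodule.exists_le_ker_of_notMem hf
  have hW'' : ∀ g ∈ W, φ g = 0 := fun g hg => hW' hg
  exact ⟨φ, hW'', hφ, exists_sum_of_filtration_le_ker φ fun g hg => hW'' g (hW hg)⟩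

/-- A point outside `W` is separated from it by a functional involving finitely many coefficients,
and such a functional is continuous. -/
theorem isClosed_of_filtration_le {n : ℕ} {W : Submodule ℂ FormalSeries}
    (hW : filtration n ≤ W) : IsClosed (W : Set FormalSeries) := by
  refine isClosed_of_closure_subset fun f hf => ?_
  by_contra hfW
  obtain ⟨φ, hφ, hne, s, c, hs⟩ := exists_functional hW hfW
  have hc : Continuous φ := by
    have : (φ : FormalSeries → ℂ) = fun f => ∑ w ∈ s, c w * f w := funext hs
    rw [this]
    exact continuous_finsetSum _ fun w _ => continuous_const.mul (continuous_coeff w)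
  have hcl : IsClosed {g | φ g = 0} := isClosed_eq hc continuous_const
  exact hne (closure_minimal (fun g hg => hφ g hg) hcl hf)

theorem tendsto_iff {α : Type*} {l : Filter α} {F : α → FormalSeries} {f : FormalSeries} :
    Tendsto F l (𝓝 f) ↔ ∀ w, Tendsto (fun x => F x w) l (𝓝 (f w)) := by
  rw [isEmbedding_coeff.tendsto_nhds_iff, tendsto_pi_nhds]; rfl

/-- A series that agrees with elements of a closed set in all weights belongs to it. -/
theorem mem_of_forall_mem_sup {A : Submodule ℂ FormalSeries}
    (hA : IsClosed (A : Set FormalSeries)) {f : FormalSeries}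
    (h : ∀ n, f ∈ A ⊔ filtration n) : f ∈ A := by
  have h' : ∀ n, ∃ a ∈ A, f - a ∈ filtration n := by
    intro n
    obtain ⟨a, ha, g, hg, rfl⟩ := Submodule.mem_sup.1 (h n)
    exact ⟨a, ha, by simpa using hg⟩
  choose a ha hfa using h'
  refine hA.mem_of_tendsto (f := a) (b := atTop) ?_ (Eventually.of_forall ha)
  refine tendsto_iff.2 fun w => tendsto_const_nhds.congr' ?_
  filter_upwards [eventually_gt_atTop (weight w)] with n hn
  exact sub_eq_zero.1 (hfa n w hn)

/-! ### Coefficientwise calculus. -/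

/-- Coefficientwise derivative of a curve of formal series. -/
def HasDeriv (f : ℝ → FormalSeries) (f' : FormalSeries) (t : ℝ) : Prop :=
  ∀ w, HasDerivAt (fun s => f s w) (f' w) t

namespace HasDeriv

variable {f g : ℝ → FormalSeries} {f' g' : FormalSeries} {t : ℝ}

theorem const (f : FormalSeries) (t : ℝ) : HasDeriv (fun _ => f) 0 t :=
  fun _ => hasDerivAt_const _ _

theorem add (hf : HasDeriv f f' t) (hg : HasDeriv g g' t) :
    HasDeriv (fun s => f s + g s) (f' + g') t := fun w => (hf w).add (hg w)

theorem sub (hf : HasDeriv f f' t) (hg : HasDeriv g g' t) :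
    HasDeriv (fun s => f s - g s) (f' - g') t := fun w => (hf w).sub (hg w)

theorem neg (hf : HasDeriv f f' t) : HasDeriv (fun s => -f s) (-f') t := fun w => (hf w).neg

theorem mul (hf : HasDeriv f f' t) (hg : HasDeriv g g' t) :
    HasDeriv (fun s => f s * g s) (f' * g t + f t * g') t := fun w => by
  simp only [mul_apply, add_apply, ← Finset.sum_add_distrib]
  exact HasDerivAt.fun_sum fun j _ => (hf _).mul (hg _)

theorem const_mul (a : FormalSeries) (hf : HasDeriv f f' t) :
    HasDeriv (fun s => a * f s) (a * f') t := by
  simpa using (const a t).mul hf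

theorem mul_const (hf : HasDeriv f f' t) (a : FormalSeries) :
    HasDeriv (fun s => f s * a) (f' * a) t := by
  simpa using hf.mul (const a t)

theorem ofReal_smul (a : FormalSeries) (t : ℝ) : HasDeriv (fun s => (s : ℂ) • a) a t := fun w => by
  have := (Complex.ofRealCLM.hasDerivAt (x := t)).mul_const (a w)
  rw [Complex.ofRealCLM_apply, Complex.ofReal_one, one_mul] at this
  exact this

theorem unique (hf : HasDeriv f f' t) (hf' : HasDeriv f g' t) : f' = g' :=
  ext fun w => (hf w).unique (hf' w)

theorem eq_of_zero (hf : ∀ t, HasDeriv f 0 t) (s t : ℝ) : f s = f t :=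
  ext fun w => is_const_of_deriv_eq_zero (fun t => (hf t w).differentiableAt)
    (fun t => (hf t w).deriv) s t

/-- Sampling the increment at `1/(n+1)` exhibits the derivative as a limit of complex multiples of
differences, which remain in any complex subspace containing the curve. -/
theorem tendsto_slope (hf : HasDeriv f f' t) :
    Tendsto (fun n : ℕ => ((n : ℂ) + 1) • (f (t + ((n : ℝ) + 1)⁻¹) - f t)) atTop (𝓝 f') := by
  refine tendsto_iff.2 fun w => ?_
  have h1 := (hf w).tendsto_slope_zero
  have h2 : Tendsto (fun n : ℕ => ((n : ℝ) + 1)⁻¹) atTop (𝓝[≠] 0) := by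
    refine tendsto_nhdsWithin_iff.2 ⟨?_, Eventually.of_forall fun n => ?_⟩
    · simpa [one_div] using tendsto_one_div_add_atTop_nhds_zero_nat (𝕜 := ℝ)
    · simp only [Set.mem_compl_iff, Set.mem_singleton_iff]; positivity
  refine (h1.comp h2).congr fun n => ?_
  simp

theorem mem_of_forall_mem {W : Submodule ℂ FormalSeries} (hW : IsClosed (W : Set FormalSeries))
    (hf : HasDeriv f f' t) (h : ∀ s, f s ∈ W) : f' ∈ W :=
  hW.mem_of_tendsto hf.tendsto_slope (Eventually.of_forall fun _ =>
    W.smul_mem _ (sub_mem (h _) (h _)))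

/-- A functional separating `f t` from `W` uses finitely many coefficients, so it can be
differentiated along the curve; its derivative vanishes, so it keeps its value `0` from time `0`. -/
theorem mem_of_deriv_mem {n : ℕ} {W : Submodule ℂ FormalSeries} (hW : filtration n ≤ W)
    {F : ℝ → FormalSeries} (hf : ∀ t, HasDeriv f (F t) t) (hF : ∀ t, F t ∈ W) (h0 : f 0 ∈ W)
    (t : ℝ) : f t ∈ W := by
  by_contra hft
  obtain ⟨φ, hφ, hne, s, c, hs⟩ := exists_functional hW hft
  have hd : ∀ t, HasDerivAt (fun r => φ (f r)) 0 t := by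
    intro t
    rw [← hφ _ (hF t)]
    simp only [hs]
    exact HasDerivAt.fun_sum fun w _ => (hf t w).const_mul _
  have := is_const_of_deriv_eq_zero (fun t => (hd t).differentiableAt)
    (fun t => (hd t).deriv) t 0
  exact hne (this.trans (hφ _ h0))

end HasDeriv

end FormalSeries

/-! ### Power series in a series without constant term, and their derivatives. -/

namespace FormalSeries

/-- The value of the power series `∑ c_k x^k` at a series without constant term. -/
noncomputable def powerSum (c : ℕ → ℂ) (f : FormalSeries) : FormalSeries :=
  ⟨fun w => ∑ k ∈ Finset.range (w.length + 1), c k * (f ^ k) w⟩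

theorem powerSum_apply (c : ℕ → ℂ) (f : FormalSeries) (w : List ℕ+) :
    powerSum c f w = ∑ k ∈ Finset.range (w.length + 1), c k * (f ^ k) w := rfl

theorem powerSum_nil (c : ℕ → ℂ) (f : FormalSeries) : powerSum c f [] = c 0 := by
  simp [powerSum_apply]

theorem continuous_powerSum (c : ℕ → ℂ) : Continuous (powerSum c) :=
  continuous_of_coeff fun w => by
    simp only [powerSum_apply]
    exact continuous_finsetSum _ fun k _ =>
      continuous_const.mul ((continuous_coeff w).comp (continuous_pow k))

theorem sum_range_eq_of_zero {M : Type*} [AddCommMonoid M] {a : ℕ → M} {m n : ℕ} (hmn : m ≤ n)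
    (h : ∀ k, m ≤ k → a k = 0) : ∑ k ∈ Finset.range m, a k = ∑ k ∈ Finset.range n, a k :=
  Finset.sum_subset (Finset.range_mono hmn) fun k _ hk => h k (by simpa using hk)

/-- The power `f ^ k` starts in weight `k`. Identities between power series can therefore be checked
on polynomials, modulo each step of the filtration. -/
theorem powerSum_sub_mem (c : ℕ → ℂ) {f : FormalSeries} (h0 : f [] = 0) {m n : ℕ} (h : m ≤ n) :
    powerSum c f - ∑ k ∈ Finset.range n, c k • f ^ k ∈ filtration m := by
  intro w hw
  have := length_le_weight w
  rw [sub_apply, powerSum_apply, sum_apply, sum_range_eq_of_zero (n := n) (by omega), sub_eq_zero]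
  · rfl
  · intro k hk
    rw [pow_apply_eq_zero h0 k w (by omega), mul_zero]

/-- The derivative of `f ^ k` in the direction `g`. -/
noncomputable def powDeriv (f g : FormalSeries) : ℕ → FormalSeries
  | 0 => 0
  | k + 1 => powDeriv f g k * f + f ^ k * g

theorem powDeriv_mem {f : FormalSeries} (h0 : f [] = 0) (g : FormalSeries) (k : ℕ) :
    powDeriv f g (k + 1) ∈ filtration k := by
  induction k with
  | zero => exact mem_filtration_zero _
  | succ k ih =>
    exact add_mem (mul_mem_filtration ih (mem_filtration_one.2 h0))
      (mul_mem_filtration_right g (pow_mem_filtration h0 _))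

/-- The derivative of `powerSum c f` in the direction `g`. -/
noncomputable def powerSumDeriv (c : ℕ → ℂ) (f g : FormalSeries) : FormalSeries :=
  ⟨fun w => ∑ k ∈ Finset.range (weight w + 1), c (k + 1) * powDeriv f g (k + 1) w⟩

theorem powerSumDeriv_sub_mem (c : ℕ → ℂ) {f : FormalSeries} (h0 : f [] = 0) (g : FormalSeries)
    (n : ℕ) :
    powerSumDeriv c f g - ∑ k ∈ Finset.range n, c (k + 1) • powDeriv f g (k + 1)
      ∈ filtration n := by
  intro w hw
  rw [sub_apply, sum_apply]
  change ∑ k ∈ Finset.range (weight w + 1), c (k + 1) * powDeriv f g (k + 1) w - _ = 0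
  rw [sum_range_eq_of_zero (n := n) (by omega), sub_eq_zero]
  · rfl
  · intro k hk
    rw [powDeriv_mem h0 g k w (by omega), mul_zero]

namespace HasDeriv

variable {f : ℝ → FormalSeries} {f' : FormalSeries} {t : ℝ}

theorem pow (hf : HasDeriv f f' t) (k : ℕ) :
    HasDeriv (fun s => f s ^ k) (powDeriv (f t) f' k) t := by
  induction k with
  | zero => simpa [powDeriv] using const 1 t
  | succ k ih => simpa only [powDeriv, pow_succ] using ih.mul hf

theorem powerSum (c : ℕ → ℂ) (h0 : ∀ s, f s [] = 0) (hf : HasDeriv f f' t) :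
    HasDeriv (fun s => powerSum c (f s)) (powerSumDeriv c (f t) f') t := by
  intro w
  -- `powerSum` is truncated by length and `powerSumDeriv` by weight; both are padded with zero
  -- terms to one range that does not depend on `s`.
  have h1 : (fun s => (FormalSeries.powerSum c (f s)) w) =
      fun s => ∑ k ∈ Finset.range (weight w + 1 + 1), c k * (f s ^ k) w := by
    funext s
    rw [powerSum_apply]
    have := length_le_weight w
    exact sum_range_eq_of_zero (by omega) fun k hk => by
      rw [pow_apply_eq_zero (h0 s) k w (by omega), mul_zero]
  have h2 : (powerSumDeriv c (f t) f') w =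
      ∑ k ∈ Finset.range (weight w + 1 + 1), c k * powDeriv (f t) f' k w := by
    rw [Finset.sum_range_succ']
    simp [powDeriv, powerSumDeriv]
  rw [h1, h2]
  exact HasDerivAt.fun_sum fun k _ => (hf.pow k w).const_mul _

end HasDeriv

theorem commute_powerSum (c : ℕ → ℂ) {f g : FormalSeries} (h0 : f [] = 0) (h : Commute f g) :
    Commute (powerSum c f) g := by
  refine eq_of_forall_sub_mem fun n => ?_
  have h1 := powerSum_sub_mem c h0 (le_refl n)
  set s := ∑ k ∈ Finset.range n, c k • f ^ k with hs
  have h2 : Commute s g := Commute.sum_left _ _ _ fun k _ => (h.pow_left k).smul_left _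
  have h3 := sub_mem (mul_mem_filtration_right g h1) (mul_mem_filtration_left g h1)
  rw [sub_mul, mul_sub, h2.eq] at h3
  simpa using h3

theorem commute_powDeriv {f g x : FormalSeries} (hf : Commute f x) (hg : Commute g x) (k : ℕ) :
    Commute (powDeriv f g k) x := by
  induction k with
  | zero => exact Commute.zero_left x
  | succ k ih => exact (ih.mul_left hf).add_left ((hf.pow_left k).mul_left hg)

theorem commute_powerSumDeriv (c : ℕ → ℂ) {f g x : FormalSeries} (h0 : f [] = 0)
    (hf : Commute f x) (hg : Commute g x) : Commute (powerSumDeriv c f g) x := by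
  refine eq_of_forall_sub_mem fun n => ?_
  have h1 := powerSumDeriv_sub_mem c h0 g n
  set s := ∑ k ∈ Finset.range n, c (k + 1) • powDeriv f g (k + 1) with hs
  have h2 : Commute s x :=
    Commute.sum_left _ _ _ fun k _ => (commute_powDeriv hf hg _).smul_left _
  have h3 := sub_mem (mul_mem_filtration_right x h1) (mul_mem_filtration_left x h1)
  rw [sub_mul, mul_sub, h2.eq] at h3
  simpa using h3

theorem powDeriv_of_commute {f g : FormalSeries} (h : Commute f g) (k : ℕ) :
    powDeriv f g (k + 1) = ((k : ℂ) + 1) • (f ^ k * g) := by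
  induction k with
  | zero => simp [powDeriv]
  | succ k ih =>
    have : f ^ k * g * f = f ^ (k + 1) * g := by rw [mul_assoc, ← h.eq, ← mul_assoc, pow_succ]
    rw [powDeriv, ih, smul_mul_assoc, this]
    push_cast
    module

/-! ### The derivative of the exponential. -/

/-- `ad_z^k w`. -/
noncomputable def adPow (z w : FormalSeries) : ℕ → FormalSeries
  | 0 => w
  | k + 1 => ⁅z, adPow z w k⁆

theorem adPow_mem {z : FormalSeries} (h0 : z [] = 0) (w : FormalSeries) (k : ℕ) :
    adPow z w k ∈ filtration k := by
  induction k with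
  | zero => exact mem_filtration_zero _
  | succ k ih =>
    have := lie_mem_filtration (mem_filtration_one.2 h0) ih
    rwa [add_comm] at this

/-- Left multiplication `L` by `z` commutes with `ad_z`, and right multiplication is `L - ad_z`. The
derivative of the `n`-th power is formally `(L ^ n - (L - ad_z) ^ n) / ad_z` applied to `w`,
expanded by the binomial formula; the induction is Pascal's rule. -/
theorem powDeriv_eq_sum_adPow (z w : FormalSeries) (n : ℕ) :
    powDeriv z w n = ∑ k ∈ Finset.range n,
      ((n.choose (k + 1) : ℂ) * (-1) ^ k) • (z ^ (n - 1 - k) * adPow z w k) := by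
  induction n with
  | zero => simp [powDeriv]
  | succ n ih =>
    have hc : ∀ k, adPow z w k * z = z * adPow z w k - adPow z w (k + 1) := by
      intro k; rw [adPow, Ring.lie_def]; abel
    have h1 : ∀ k ∈ Finset.range n,
        (((n.choose (k + 1) : ℂ) * (-1) ^ k) • (z ^ (n - 1 - k) * adPow z w k)) * z =
        ((n.choose (k + 1) : ℂ) * (-1) ^ k) • (z ^ (n - k) * adPow z w k) +
        ((n.choose (k + 1) : ℂ) * (-1) ^ (k + 1)) • (z ^ (n - (k + 1)) * adPow z w (k + 1)) := by
      intro k hk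
      have hk := Finset.mem_range.1 hk
      have e : n - k = n - 1 - k + 1 := by omega
      have e' : n - (k + 1) = n - 1 - k := by omega
      rw [e, e', smul_mul_assoc, mul_assoc, hc, mul_sub, ← mul_assoc, ← pow_succ]
      module
    have h2 : ∑ k ∈ Finset.range (n + 1),
        ((n.choose (k + 1) : ℂ) * (-1) ^ k) • (z ^ (n - k) * adPow z w k) =
        ∑ k ∈ Finset.range n,
          ((n.choose (k + 1) : ℂ) * (-1) ^ k) • (z ^ (n - k) * adPow z w k) := by
      rw [Finset.sum_range_succ]; simp
    have h3 : ∑ k ∈ Finset.range (n + 1),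
        ((n.choose k : ℂ) * (-1) ^ k) • (z ^ (n - k) * adPow z w k) =
        ∑ k ∈ Finset.range n,
          ((n.choose (k + 1) : ℂ) * (-1) ^ (k + 1)) •
            (z ^ (n - (k + 1)) * adPow z w (k + 1)) + z ^ n * w := by
      rw [Finset.sum_range_succ']; simp [adPow]
    rw [powDeriv, ih, Finset.sum_mul, Finset.sum_congr rfl h1, Finset.sum_add_distrib, add_assoc,
      ← h3, ← h2, ← Finset.sum_add_distrib]
    refine Finset.sum_congr rfl fun k _ => ?_
    rw [Nat.choose_succ_succ]
    simp only [Nat.succ_eq_add_one, Nat.add_sub_cancel]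
    push_cast
    module

/-- The coefficients of the exponential series. -/
noncomputable def expCoeff (k : ℕ) : ℂ := (k.factorial : ℂ)⁻¹

/-- The formula for the derivative of the exponential map, modulo terms of large weight. -/
theorem powerSumDeriv_exp_sub_mem {z : FormalSeries} (h0 : z [] = 0) (w : FormalSeries) (n : ℕ) :
    powerSumDeriv expCoeff z w - powerSum expCoeff z *
      ∑ k ∈ Finset.range n, ((-1) ^ k * expCoeff (k + 1)) • adPow z w k ∈ filtration n := by
  have h1 := powerSumDeriv_sub_mem expCoeff h0 w n
  have h2 : ∑ m ∈ Finset.range n, expCoeff (m + 1) • powDeriv z w (m + 1) =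
      ∑ k ∈ Finset.range n, (∑ j ∈ Finset.range (n - k), expCoeff j • z ^ j) *
        (((-1) ^ k * expCoeff (k + 1)) • adPow z w k) := by
    -- Dividing the binomial coefficient of `m + 1` over `k + 1` by `(m + 1)!` leaves `1 / ((m - k)!
    -- (k + 1)!)`, so the sum becomes a Cauchy product.
    have h3 : ∀ m, expCoeff (m + 1) • powDeriv z w (m + 1) =
        ∑ k ∈ Finset.range (m + 1), (expCoeff (m - k) • z ^ (m - k)) *
        (((-1) ^ k * expCoeff (k + 1)) • adPow z w k) := by
      intro m
      rw [powDeriv_eq_sum_adPow, Finset.smul_sum]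
      refine Finset.sum_congr rfl fun k hk => ?_
      have hk := Finset.mem_range.1 hk
      rw [smul_mul_smul_comm, smul_smul, Nat.add_sub_cancel]
      congr 1
      rw [Nat.cast_choose ℂ (show k + 1 ≤ m + 1 by omega), Nat.add_sub_add_right]
      simp only [expCoeff]
      have := Nat.cast_ne_zero (R := ℂ).2 (m + 1).factorial_ne_zero
      have := Nat.cast_ne_zero (R := ℂ).2 (k + 1).factorial_ne_zero
      have := Nat.cast_ne_zero (R := ℂ).2 (m - k).factorial_ne_zero
      field_simp
    simp only [h3, Finset.sum_mul]
    rw [Finset.sum_sigma', Finset.sum_sigma']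
    -- The triangle `k ≤ m < n` is reindexed by `(k, j)` with `j = m - k`.
    refine Finset.sum_bij' (fun p _ => ⟨p.2, p.1 - p.2⟩) (fun p _ => ⟨p.1 + p.2, p.1⟩) ?_ ?_ ?_ ?_ ?_
    all_goals
      rintro ⟨a, b⟩ h
      simp only [Finset.mem_sigma, Finset.mem_range] at h ⊢
    · omega
    · omega
    · rw [show b + (a - b) = a by omega]
    · rw [show a + b - a = b by omega]
  rw [h2] at h1
  have h4 : ∑ k ∈ Finset.range n, (∑ j ∈ Finset.range (n - k), expCoeff j • z ^ j) *
        (((-1) ^ k * expCoeff (k + 1)) • adPow z w k) - powerSum expCoeff z *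
      ∑ k ∈ Finset.range n, ((-1) ^ k * expCoeff (k + 1)) • adPow z w k ∈ filtration n := by
    rw [Finset.mul_sum, ← Finset.sum_sub_distrib]
    refine sum_mem fun k hk => ?_
    have hk := Finset.mem_range.1 hk
    rw [← sub_mul]
    have := mul_mem_filtration
      (neg_mem (powerSum_sub_mem expCoeff h0 (le_refl (n - k))))
      (Submodule.smul_mem _ ((-1) ^ k * expCoeff (k + 1)) (adPow_mem h0 w k))
    rwa [neg_sub, Nat.sub_add_cancel hk.le] at this
  simpa using add_mem h1 h4

theorem powerSumDeriv_exp_of_commute {z w : FormalSeries} (h0 : z [] = 0) (h : Commute z w) :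
    powerSumDeriv expCoeff z w = powerSum expCoeff z * w := by
  refine eq_of_forall_sub_mem fun n => ?_
  have h1 := filtration_anti (Nat.le_succ n) (powerSumDeriv_exp_sub_mem h0 w (n + 1))
  rw [Finset.sum_range_succ'] at h1
  have h2 : ∀ k, adPow z w (k + 1) = 0 := by
    intro k
    induction k with
    | zero => simp [adPow, Ring.lie_def, h.eq]
    | succ k ih => rw [adPow, ih, lie_zero]
  simp only [h2, smul_zero, Finset.sum_const_zero, zero_add] at h1
  simpa [adPow, expCoeff] using h1

end FormalSeries

/-! ### Exponential and logarithm. -/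

namespace FormalSeries

theorem exp_eq_powerSum {f : FormalSeries} (h0 : f [] = 0) : exp f = powerSum expCoeff f :=
  (hasSum_pow h0 _).tsum_eq

/-- The coefficients of the series of `log (1 - x)`. -/
noncomputable def logCoeff (k : ℕ) : ℂ := -(k : ℂ)⁻¹

theorem log_eq_powerSum {f : FormalSeries} (h1 : f [] = 1) :
    log f = powerSum logCoeff (1 - f) := by
  have h0 : (1 - f) [] = 0 := by simp [h1]
  have h := (hasSum_pow h0 fun k => (k : ℂ)⁻¹)
  have h2 := (hasSum_nat_add_iff' 1).2 h
  rw [Finset.sum_range_one] at h2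
  simp only [Nat.cast_zero, inv_zero, zero_smul, sub_zero, Nat.cast_add, Nat.cast_one] at h2
  rw [log, h2.tsum_eq]
  ext w
  simp [powerSum_apply, logCoeff]

theorem exp_zero : exp 0 = 1 := by
  rw [exp_eq_powerSum rfl]
  ext w
  rw [powerSum_apply, Finset.sum_range_succ']
  simp [expCoeff]

theorem log_one : log 1 = 0 := by
  rw [log_eq_powerSum rfl, sub_self]
  ext w
  rw [powerSum_apply, Finset.sum_range_succ']
  simp [logCoeff]

theorem log_nil {f : FormalSeries} (h1 : f [] = 1) : log f [] = 0 := by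
  rw [log_eq_powerSum h1, powerSum_nil]; simp [logCoeff]

namespace HasDeriv

variable {f : ℝ → FormalSeries} {f' : FormalSeries} {t : ℝ}

theorem exp (h0 : ∀ s, f s [] = 0) (hf : HasDeriv f f' t) :
    HasDeriv (fun s => exp (f s)) (powerSumDeriv expCoeff (f t) f') t := by
  simp only [exp_eq_powerSum (h0 _)]
  exact hf.powerSum expCoeff h0

theorem exp_of_commute (h0 : ∀ s, f s [] = 0) (hf : HasDeriv f f' t) (h : Commute (f t) f') :
    HasDeriv (fun s => FormalSeries.exp (f s)) (FormalSeries.exp (f t) * f') t := by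
  rw [exp_eq_powerSum (h0 t), ← powerSumDeriv_exp_of_commute (h0 t) h]
  exact hf.exp h0

theorem exp_smul {a : FormalSeries} (h0 : a [] = 0) (t : ℝ) :
    HasDeriv (fun s => FormalSeries.exp ((s : ℂ) • a)) (FormalSeries.exp ((t : ℂ) • a) * a) t :=
  (ofReal_smul a t).exp_of_commute (fun s => by simp [-Complex.coe_smul, h0]) ((Commute.refl a).smul_left _)

theorem log (h1 : ∀ s, f s [] = 1) (hf : HasDeriv f f' t) :
    HasDeriv (fun s => log (f s)) (powerSumDeriv logCoeff (1 - f t) (-f')) t := by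
  simp only [log_eq_powerSum (h1 _)]
  refine HasDeriv.powerSum logCoeff (fun s => by simp [h1]) ?_
  simpa using (const 1 t).sub hf

end HasDeriv

theorem commute_exp {f g : FormalSeries} (h0 : f [] = 0) (h : Commute f g) :
    Commute (exp f) g := by
  rw [exp_eq_powerSum h0]; exact commute_powerSum _ h0 h

theorem commute_log {f g : FormalSeries} (h1 : f [] = 1) (h : Commute f g) :
    Commute (log f) g := by
  rw [log_eq_powerSum h1]
  exact commute_powerSum _ (by simp [h1]) ((Commute.one_left g).sub_left h)

/-- Under commutation the factor `k + 1` from differentiating a power cancels the coefficient of the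
logarithm, leaving the geometric series in `1 - f`, which inverts `f`. -/
theorem mul_powerSumDeriv_log {f w : FormalSeries} (h1 : f [] = 1) (h : Commute f w) :
    f * powerSumDeriv logCoeff (1 - f) (-w) = w := by
  refine eq_of_forall_sub_mem fun n => ?_
  have h0 : (1 - f) [] = 0 := by simp [h1]
  have h2 := mul_mem_filtration_left f (powerSumDeriv_sub_mem logCoeff h0 (-w) n)
  have hc : Commute (1 - f) (-w) := ((Commute.one_left w).sub_left h).neg_right
  have h3 : ∑ k ∈ Finset.range n, logCoeff (k + 1) • powDeriv (1 - f) (-w) (k + 1) =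
      (∑ k ∈ Finset.range n, (1 - f) ^ k) * w := by
    rw [Finset.sum_mul]
    refine Finset.sum_congr rfl fun k _ => ?_
    rw [powDeriv_of_commute hc, smul_smul, logCoeff]
    have : ((k : ℂ) + 1) ≠ 0 := by exact_mod_cast k.succ_ne_zero
    push_cast
    rw [neg_mul, inv_mul_cancel₀ this, mul_neg]
    simp
  have h4 := mul_neg_geom_sum (1 - f) n
  rw [sub_sub_cancel] at h4
  rw [h3, mul_sub, ← mul_assoc, h4, sub_mul, one_mul] at h2
  have h5 := sub_mem h2 (mul_mem_filtration_right w (pow_mem_filtration h0 n))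
  convert h5 using 1
  abel

/-- The curve `e^{-sa} e^{sa}` has zero derivative, hence is constant. `exp_add_of_commute`,
`log_exp` and `exp_log` follow the same scheme with other constant curves. -/
theorem exp_neg_mul_exp {a : FormalSeries} (h0 : a [] = 0) : exp (-a) * exp a = 1 := by
  have h : ∀ t, HasDeriv (fun s => exp ((s : ℂ) • -a) * exp ((s : ℂ) • a)) 0 t := by
    intro t
    have h1 := (HasDeriv.exp_smul (a := -a) (by simp [-Complex.coe_smul, h0]) t).mul (HasDeriv.exp_smul h0 t)
    have h2 : Commute (exp ((t : ℂ) • a)) a :=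
      commute_exp (by simp [-Complex.coe_smul, h0]) ((Commute.refl a).smul_left _)
    convert h1 using 1
    rw [h2.eq]
    noncomm_ring
  have := HasDeriv.eq_of_zero h 1 0
  simpa [exp_zero] using this

theorem exp_mul_exp_neg {a : FormalSeries} (h0 : a [] = 0) : exp a * exp (-a) = 1 := by
  simpa using exp_neg_mul_exp (a := -a) (by simp [-Complex.coe_smul, h0])

theorem exp_add_of_commute {a b : FormalSeries} (ha : a [] = 0) (hb : b [] = 0)
    (hab : Commute a b) : exp (a + b) = exp a * exp b := by
  have h : ∀ t, HasDeriv (fun s => exp ((s : ℂ) • -a) * exp ((s : ℂ) • a + b)) 0 t := by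
    intro t
    have hc : Commute ((t : ℂ) • a + b) a := ((Commute.refl a).smul_left _).add_left hab.symm
    have h0 : ∀ s : ℝ, ((s : ℂ) • a + b) [] = 0 := fun s => by simp [-Complex.coe_smul, ha, hb]
    have h3 : HasDeriv (fun s : ℝ => (s : ℂ) • a + b) a t := by
      simpa using (HasDeriv.ofReal_smul a t).add (HasDeriv.const b t)
    have h1 := (HasDeriv.exp_smul (a := -a) (by simp [-Complex.coe_smul, ha]) t).mul (h3.exp_of_commute h0 hc)
    convert h1 using 1
    rw [(commute_exp (h0 t) hc).eq]
    noncomm_ring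
  have := HasDeriv.eq_of_zero h 1 0
  simp only [Complex.ofReal_one, Complex.ofReal_zero, one_smul, zero_smul, zero_add, exp_zero,
    one_mul] at this
  rw [← this, ← mul_assoc, exp_mul_exp_neg ha, one_mul]

theorem log_exp {a : FormalSeries} (h0 : a [] = 0) : log (exp a) = a := by
  have h : ∀ t, HasDeriv (fun s => log (exp ((s : ℂ) • a)) - (s : ℂ) • a) 0 t := by
    intro t
    have hs : ∀ s : ℝ, ((s : ℂ) • a) [] = 0 := fun s => by simp [-Complex.coe_smul, h0]
    have h1 := (HasDeriv.exp_smul h0 t).log (fun s => exp_nil (hs s))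
    have hc : Commute (exp ((t : ℂ) • a)) a := commute_exp (hs t) ((Commute.refl a).smul_left _)
    have h2 := mul_powerSumDeriv_log (exp_nil (hs t)) ((Commute.refl _).mul_right hc)
    have h3 := congrArg (exp (-((t : ℂ) • a)) * ·) h2
    simp only [← mul_assoc, exp_neg_mul_exp (hs t), one_mul] at h3
    rw [h3] at h1
    simpa using h1.sub (HasDeriv.ofReal_smul a t)
  have := HasDeriv.eq_of_zero h 1 0
  simpa [exp_zero, log_one, sub_eq_zero] using this

theorem exp_log {f : FormalSeries} (h1 : f [] = 1) : exp (log f) = f := by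
  set u := f - 1 with hu
  have hu0 : u [] = 0 := by simp [hu, h1]
  have hf1 : ∀ s : ℝ, (1 + (s : ℂ) • u) [] = 1 := fun s => by simp [-Complex.coe_smul, hu0]
  have h : ∀ t, HasDeriv (fun s => exp (-log (1 + (s : ℂ) • u)) * (1 + (s : ℂ) • u)) 0 t := by
    intro t
    have hf : HasDeriv (fun s : ℝ => 1 + (s : ℂ) • u) u t := by
      simpa using (HasDeriv.const 1 t).add (HasDeriv.ofReal_smul u t)
    have hc : Commute (1 + (t : ℂ) • u) u :=
      (Commute.one_left u).add_left ((Commute.refl u).smul_left _)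
    have hn0 : (1 - (1 + (t : ℂ) • u)) [] = 0 := by simp [-Complex.coe_smul, hu0]
    have hd : ∀ x, Commute u x →
        Commute (powerSumDeriv logCoeff (1 - (1 + (t : ℂ) • u)) (-u)) x := fun x hx =>
      commute_powerSumDeriv _ hn0 ((Commute.one_left x).sub_left
        ((Commute.one_left x).add_left (hx.smul_left _))) hx.neg_left
    have hl := hf.log hf1
    have hcl : Commute (log (1 + (t : ℂ) • u))
        (powerSumDeriv logCoeff (1 - (1 + (t : ℂ) • u)) (-u)) :=
      ((hd _ (commute_log (hf1 t) hc).symm).symm)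
    have he := (hl.neg.exp_of_commute (fun s => by simp [-Complex.coe_smul, log_nil (hf1 s)])
      hcl.neg_left.neg_right).mul hf
    convert he using 1
    have hm := mul_powerSumDeriv_log (hf1 t) hc
    rw [← (hd _ hc.symm).eq] at hm
    rw [mul_assoc, neg_mul, hm]
    noncomm_ring
  have := HasDeriv.eq_of_zero h 1 0
  simp only [Complex.ofReal_one, Complex.ofReal_zero, one_smul, zero_smul, add_zero, log_one,
    neg_zero, exp_zero, one_mul, hu, add_sub_cancel] at this
  have h2 := exp_mul_exp_neg (log_nil h1)
  calc exp (log f) = exp (log f) * (exp (-log f) * f) := by rw [this, mul_one]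
    _ = f := by rw [← mul_assoc, h2, one_mul]

theorem exp_nsmul {a : FormalSeries} (h0 : a [] = 0) (n : ℕ) :
    exp ((n : ℂ) • a) = exp a ^ n := by
  induction n with
  | zero => simp [exp_zero]
  | succ n ih =>
    rw [Nat.cast_succ, add_smul, one_smul, exp_add_of_commute (by simp [-Complex.coe_smul, h0]) h0
      ((Commute.refl a).smul_left _), ih, pow_succ]

theorem sub_exp_mem {f : FormalSeries} (h0 : f [] = 0) (n : ℕ) :
    exp f - ∑ k ∈ Finset.range n, expCoeff k • f ^ k ∈ filtration n := by
  rw [exp_eq_powerSum h0]; exact powerSum_sub_mem _ h0 le_rfl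

end FormalSeries

/-! ### Conjugation by elements of `G`. -/

namespace UnitSeries

theorem mul_inv_val (g : UnitSeries) : g.val * (g⁻¹).val = 1 := by
  rw [← coe_mul, mul_inv_cancel]; rfl

theorem inv_mul_val (g : UnitSeries) : (g⁻¹).val * g.val = 1 := by
  rw [← coe_mul, inv_mul_cancel]; rfl

/-- Conjugation of a series by an element of `G`. -/
def conj (g : UnitSeries) (a : FormalSeries) : FormalSeries := g.val * a * (g⁻¹).val

theorem conj_nil (g : UnitSeries) (a : FormalSeries) : g.conj a [] = a [] := by
  simp [conj]

theorem conj_smul (g : UnitSeries) (c : ℂ) (a : FormalSeries) :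
    g.conj (c • a) = c • g.conj a := by
  simp [conj]

theorem conj_pow (g : UnitSeries) (a : FormalSeries) (n : ℕ) :
    g.conj (a ^ n) = g.conj a ^ n := by
  induction n with
  | zero => simp [conj, mul_inv_val]
  | succ n ih =>
    rw [pow_succ (g.conj a), ← ih, pow_succ]
    simp only [conj]
    calc g.val * (a ^ n * a) * (g⁻¹).val = g.val * a ^ n * 1 * a * (g⁻¹).val := by noncomm_ring
      _ = _ := by rw [← inv_mul_val g]; simp only [mul_assoc]

theorem exp_conj (g : UnitSeries) {a : FormalSeries} (h0 : a [] = 0) :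
    FormalSeries.exp (g.conj a) = g.conj (FormalSeries.exp a) := by
  refine FormalSeries.eq_of_forall_sub_mem fun n => ?_
  have h1 := FormalSeries.mul_mem_filtration_right (g⁻¹).val
    (FormalSeries.mul_mem_filtration_left g.val (FormalSeries.sub_exp_mem h0 n))
  have h2 := FormalSeries.sub_exp_mem (f := g.conj a) (by rw [conj_nil, h0]) n
  have h3 : ∑ k ∈ Finset.range n, FormalSeries.expCoeff k • g.conj a ^ k =
      g.val * (∑ k ∈ Finset.range n, FormalSeries.expCoeff k • a ^ k) * (g⁻¹).val := by
    simp only [← conj_pow, ← conj_smul]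
    simp only [conj, Finset.mul_sum, Finset.sum_mul]
  rw [h3] at h2
  have h4 := sub_mem h2 h1
  convert h4 using 1
  simp only [conj, mul_sub, sub_mul]
  abel

end UnitSeries

/-! ### The exponential into `G` and the Lie algebra of a closed subgroup. -/

namespace UnitSeries

open FormalSeries

/-- The exponential as a map into `G`; only its values at series without constant term matter. -/
noncomputable def ofExp (a : FormalSeries) : UnitSeries :=
  ⟨powerSum expCoeff a, by simp [powerSum_nil, expCoeff]⟩

theorem ofExp_val {a : FormalSeries} (h0 : a [] = 0) : (ofExp a).val = FormalSeries.exp a :=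
  (exp_eq_powerSum h0).symm

theorem continuous_ofExp : Continuous ofExp :=
  isEmbedding_val.continuous_iff.2 (continuous_powerSum _)

theorem continuous_log : Continuous fun g : UnitSeries => FormalSeries.log g.val := by
  have : (fun g : UnitSeries => FormalSeries.log g.val) =
      fun g => powerSum logCoeff (1 - g.val) := funext fun g => log_eq_powerSum g.nil
  rw [this]
  exact (continuous_powerSum _).comp (continuous_const.sub isEmbedding_val.continuous)

theorem ofExp_log (g : UnitSeries) : ofExp (FormalSeries.log g.val) = g :=
  val_injective (by rw [ofExp_val (log_nil g.nil), exp_log g.nil])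

theorem log_ofExp {a : FormalSeries} (h0 : a [] = 0) : FormalSeries.log (ofExp a).val = a := by
  rw [ofExp_val h0, log_exp h0]

theorem ofExp_zero : ofExp 0 = 1 := val_injective (by rw [ofExp_val rfl, exp_zero]; rfl)

theorem ofExp_neg {a : FormalSeries} (h0 : a [] = 0) : ofExp (-a) = (ofExp a)⁻¹ := by
  refine eq_inv_of_mul_eq_one_left (val_injective ?_)
  rw [coe_mul, ofExp_val h0, ofExp_val (by simp [h0]), exp_neg_mul_exp h0]; rfl

theorem log_inv (g : UnitSeries) :
    FormalSeries.log (g⁻¹).val = -FormalSeries.log g.val := by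
  have h0 := log_nil g.nil
  conv_lhs => rw [← ofExp_log g, ← ofExp_neg h0]
  rw [log_ofExp (by simp [h0])]

theorem ofExp_nsmul {a : FormalSeries} (h0 : a [] = 0) (n : ℕ) :
    ofExp ((n : ℂ) • a) = ofExp a ^ n := by
  induction n with
  | zero => simp [ofExp_zero]
  | succ n ih =>
    refine val_injective ?_
    rw [pow_succ, ← ih, coe_mul, ofExp_val h0, ofExp_val (by simp [h0]),
      ofExp_val (by simp [h0]), exp_nsmul h0, exp_nsmul h0, pow_succ]

theorem ofExp_conj (g : UnitSeries) {a : FormalSeries} (h0 : a [] = 0) :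
    ofExp (g.conj a) = g * ofExp a * g⁻¹ := by
  refine val_injective ?_
  rw [ofExp_val (by rw [conj_nil, h0]), exp_conj g h0, conj, coe_mul, coe_mul, ofExp_val h0]

theorem hasDeriv_conj_ofExp {x : FormalSeries} (hx : x [] = 0) (a : FormalSeries) :
    HasDeriv (fun s : ℝ => (ofExp ((s : ℂ) • x)).conj a) ⁅x, a⁆ 0 := by
  have hx' : ∀ s : ℝ, ((s : ℂ) • x) [] = 0 := fun s => by simp [-Complex.coe_smul, hx]
  have h : (fun s : ℝ => (ofExp ((s : ℂ) • x)).conj a) =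
      fun s : ℝ => FormalSeries.exp ((s : ℂ) • x) * a * FormalSeries.exp ((s : ℂ) • -x) := by
    funext s
    rw [conj, ← ofExp_neg (hx' s), ofExp_val (hx' s), ofExp_val, smul_neg]
    rw [neg_apply, hx' s, neg_zero]
  rw [h]
  have := ((HasDeriv.exp_smul hx 0).mul_const a).mul
    (HasDeriv.exp_smul (a := -x) (by simp [hx]) 0)
  convert this using 1
  simp only [Complex.ofReal_zero, zero_smul, exp_zero, one_mul, mul_one, mul_neg, Ring.lie_def]
  abel

/-- The Lie product formula: `n log (e^{a/n} e^{b/n})` tends to `a + b`. -/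
theorem tendsto_log_mul {a b : FormalSeries} (ha : a [] = 0) (hb : b [] = 0) :
    Tendsto (fun n : ℕ => ((n + 1 : ℕ) : ℂ) • FormalSeries.log
      (ofExp (((n : ℂ) + 1)⁻¹ • a) * ofExp (((n : ℂ) + 1)⁻¹ • b)).val) atTop (𝓝 (a + b)) := by
  -- The limit is the derivative at `0` of `log (e^{sa} e^{sb})`, sampled at `s = 1/(n+1)`.
  have hd : HasDeriv (fun s : ℝ => FormalSeries.log
      (FormalSeries.exp ((s : ℂ) • a) * FormalSeries.exp ((s : ℂ) • b))) (a + b) 0 := by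
    have h1 := (HasDeriv.exp_smul ha 0).mul (HasDeriv.exp_smul hb 0)
    have h2 := h1.log fun s => by
      rw [mul_nil, exp_nil (by simp [-Complex.coe_smul, ha]),
        exp_nil (by simp [-Complex.coe_smul, hb]), one_mul]
    simp only [Complex.ofReal_zero, zero_smul, exp_zero, one_mul, mul_one] at h2
    have h3 := mul_powerSumDeriv_log (f := 1) (w := a + b) rfl (Commute.one_left _)
    rw [one_mul] at h3
    rwa [h3] at h2
  refine hd.tendsto_slope.congr fun n => ?_
  have e : ∀ c : FormalSeries, c [] = 0 → (((n : ℂ) + 1)⁻¹ • c) [] = 0 := fun c hc => by simp [hc]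
  rw [coe_mul, ofExp_val (e a ha), ofExp_val (e b hb)]
  simp [-Complex.coe_smul, exp_zero, log_one]

theorem isClosed_setOf_ofExp_mem {K : Subgroup UnitSeries} (hK : IsClosed (K : Set UnitSeries)) :
    IsClosed {a : FormalSeries | a [] = 0 ∧ ∀ c : ℂ, ofExp (c • a) ∈ K} := by
  have h : {a : FormalSeries | a [] = 0 ∧ ∀ c : ℂ, ofExp (c • a) ∈ K} =
      {a | a [] = 0} ∩ ⋂ c : ℂ, (fun a => ofExp (c • a)) ⁻¹' K := by ext; simp
  rw [h]
  exact (isClosed_eq (continuous_coeff []) continuous_const).inter (isClosed_iInter fun c =>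
    hK.preimage (continuous_ofExp.comp
      (continuous_of_coeff fun w => continuous_const.mul (continuous_coeff w))))

/-- The Lie algebra of a closed subgroup of `G`: all `a` with `e^{c a}` in the subgroup for all
complex `c`. -/
noncomputable def lieAlgebra (K : Subgroup UnitSeries) (hK : IsClosed (K : Set UnitSeries)) :
    LieSubalgebra ℂ FormalSeries :=
  let W : Submodule ℂ FormalSeries :=
    { carrier := {a | a [] = 0 ∧ ∀ c : ℂ, ofExp (c • a) ∈ K}
      zero_mem' := ⟨rfl, fun c => by rw [smul_zero, ofExp_zero]; exact K.one_mem⟩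
      smul_mem' := fun c a ha => ⟨by simp [ha.1], fun d => by rw [smul_smul]; exact ha.2 _⟩
      add_mem' := by
        rintro a b ⟨ha, ha'⟩ ⟨hb, hb'⟩
        refine ⟨by simp [ha, hb], fun c => ?_⟩
        -- With `m = n + 1`, `e^{c(a+b)}` is the limit of `(e^{ca/m} e^{cb/m})^m`, which lies in the
        -- closed group `K`.
        have h := (continuous_ofExp.tendsto _).comp
          (tendsto_log_mul (a := c • a) (b := c • b) (by simp [ha]) (by simp [hb]))
        rw [smul_add]
        refine hK.mem_of_tendsto h (Eventually.of_forall fun n => ?_)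
        rw [Function.comp_apply, ofExp_nsmul (log_nil (UnitSeries.nil _)), ofExp_log]
        refine K.pow_mem (K.mul_mem ?_ ?_) _
        · rw [smul_smul]; exact ha' _
        · rw [smul_smul]; exact hb' _ }
  { W with
    lie_mem' := by
      rintro a b ⟨ha, ha'⟩ ⟨hb, hb'⟩
      -- The bracket is the derivative at `0` of `e^{sa} b e^{-sa}`. This curve stays in `W`,
      -- because exponentiating its multiples gives conjugates of `e^{cb}` by elements of `K`.
      refine (hasDeriv_conj_ofExp ha b).mem_of_forall_mem (W := W) (isClosed_setOf_ofExp_mem hK) fun s => ?_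
      refine ⟨by rw [conj_nil, hb], fun c => ?_⟩
      rw [← conj_smul, ofExp_conj _ (by simp [hb])]
      exact K.mul_mem (K.mul_mem (ha' _) (hb' _)) (K.inv_mem (ha' _)) }

theorem isClosed_lieAlgebra (K : Subgroup UnitSeries) (hK : IsClosed (K : Set UnitSeries)) :
    IsClosed (lieAlgebra K hK : Set FormalSeries) := isClosed_setOf_ofExp_mem hK

theorem ofExp_mem_of_mem_lieAlgebra {K : Subgroup UnitSeries}
    {hK : IsClosed (K : Set UnitSeries)} {a : FormalSeries} (ha : a ∈ lieAlgebra K hK) :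
    ofExp a ∈ K := by
  simpa using ha.2 1

end UnitSeries

/-! ### Baker-Campbell-Hausdorff and the group `e^A`. -/

namespace FormalSeries

/-- Every term of the expanded bracket other than the one inside `A` pairs an error of weight at
least `n + 1` with a series without constant term. This gain of one weight drives the induction in
`log_exp_mul_exp_mem`. -/
theorem lie_mem_sup_filtration {A : LieSubalgebra ℂ FormalSeries}
    (hA : ∀ a ∈ A, a [] = 0) {n : ℕ} {z w : FormalSeries}
    (hz : z ∈ A.toSubmodule ⊔ filtration (n + 1)) (hw : w ∈ A.toSubmodule ⊔ filtration (n + 1)) :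
    ⁅z, w⁆ ∈ A.toSubmodule ⊔ filtration (n + 2) := by
  obtain ⟨a, ha, f, hf, rfl⟩ := Submodule.mem_sup.1 hz
  obtain ⟨b, hb, g, hg, rfl⟩ := Submodule.mem_sup.1 hw
  have ha1 := mem_filtration_one.2 (hA a ha)
  have hb1 := mem_filtration_one.2 (hA b hb)
  have hf1 := filtration_anti (show 1 ≤ n + 1 by omega) hf
  rw [add_lie, lie_add, add_assoc]
  refine Submodule.add_mem_sup (A.lie_mem ha hb) (add_mem ?_ ?_)
  · exact filtration_anti (by omega) (lie_mem_filtration ha1 hg)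
  · rw [lie_add]
    exact add_mem (filtration_anti (by omega) (lie_mem_filtration hf hb1))
      (filtration_anti (by omega) (lie_mem_filtration hf hg))

theorem isClosed_sup_filtration (A : Submodule ℂ FormalSeries) (n : ℕ) :
    IsClosed (A ⊔ filtration n : Submodule ℂ FormalSeries).carrier :=
  isClosed_of_filtration_le le_sup_right

/-- Baker–Campbell–Hausdorff: a closed Lie algebra `A` of series without constant term contains
`log (e^a e^b)` for all `a, b ∈ A`. -/
theorem log_exp_mul_exp_mem {A : LieSubalgebra ℂ FormalSeries}
    (hcl : IsClosed (A : Set FormalSeries)) (hA : ∀ a ∈ A, a [] = 0) {a b : FormalSeries}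
    (ha : a ∈ A) (hb : b ∈ A) : log (exp a * exp b) ∈ A := by
  have ha0 := hA a ha
  have hb0 := hA b hb
  have hb0' : ∀ s : ℝ, ((s : ℂ) • b) [] = 0 := fun s => by simp [-Complex.coe_smul, hb0]
  have hg1 : ∀ s : ℝ, (exp a * exp ((s : ℂ) • b)) [] = 1 := fun s => by
    rw [mul_nil, exp_nil ha0, exp_nil (hb0' s), one_mul]
  have hgd : ∀ t : ℝ, HasDeriv (fun s => exp a * exp ((s : ℂ) • b))
      (exp a * exp ((t : ℂ) • b) * b) t := fun t => by
    rw [mul_assoc]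
    exact (HasDeriv.exp_smul hb0 t).const_mul _
  set z : ℝ → FormalSeries := fun s => log (exp a * exp ((s : ℂ) • b)) with hz
  have hz0 : ∀ s, z s [] = 0 := fun s => log_nil (hg1 s)
  obtain ⟨z', hz'⟩ : ∃ z' : ℝ → FormalSeries, ∀ t, HasDeriv z (z' t) t :=
    ⟨_, fun t => (hgd t).log hg1⟩
  have hexp : ∀ s, exp (z s) = exp a * exp ((s : ℂ) • b) := fun s => exp_log (hg1 s)
  -- Differentiating `e^z = e^a e^{tb}` in two ways and cancelling `e^z` gives `b = ∑ (-1)^k /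
  -- (k+1)! ad_z^k z'`.
  have hrel : ∀ t n, b - ∑ k ∈ Finset.range n, ((-1) ^ k * expCoeff (k + 1)) • adPow (z t) (z' t) k
      ∈ filtration n := by
    intro t n
    have h1 := (hz' t).exp hz0
    simp only [hexp] at h1
    have h2 := powerSumDeriv_exp_sub_mem (hz0 t) (z' t) n
    rw [h1.unique (hgd t), ← hexp, ← exp_eq_powerSum (hz0 t), ← mul_sub] at h2
    have h3 := mul_mem_filtration_left (exp (-z t)) h2
    rwa [← mul_assoc, exp_neg_mul_exp (hz0 t), one_mul] at h3
  have key : ∀ n t, z t ∈ A.toSubmodule ⊔ filtration (n + 1) := by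
    intro n
    induction n with
    | zero =>
      exact fun t => (le_sup_right : filtration 1 ≤ _) (mem_filtration_one.2 (hz0 t))
    | succ n ih =>
      refine HasDeriv.mem_of_deriv_mem le_sup_right hz' (fun t => ?_) ?_
      -- The derivative inherits membership modulo weight `n + 1`; all terms with `k ≥ 1` then lie
      -- in `A` modulo weight `n + 2`, and solving the relation for the `k = 0` term, which is `z'`,
      -- improves `z'` as well.
      · have h1 : z' t ∈ A.toSubmodule ⊔ filtration (n + 1) :=
          (hz' t).mem_of_forall_mem (isClosed_sup_filtration _ _) ih
        have h2 : ∀ k, adPow (z t) (z' t) (k + 1) ∈ A.toSubmodule ⊔ filtration (n + 2) := by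
          have hle : A.toSubmodule ⊔ filtration (n + 2) ≤ A.toSubmodule ⊔ filtration (n + 1) :=
            sup_le_sup_left (filtration_anti (by omega)) _
          intro k
          induction k with
          | zero => exact lie_mem_sup_filtration hA (ih t) h1
          | succ k ihk => exact lie_mem_sup_filtration hA (ih t) (hle ihk)
        have h3 := hrel t (n + 2 + 1)
        rw [Finset.sum_range_succ'] at h3
        have h4 : z' t = b - ∑ k ∈ Finset.range (n + 2),
            ((-1) ^ (k + 1) * expCoeff (k + 1 + 1)) • adPow (z t) (z' t) (k + 1) -
            (b - (∑ k ∈ Finset.range (n + 2),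
            ((-1) ^ (k + 1) * expCoeff (k + 1 + 1)) • adPow (z t) (z' t) (k + 1) +
            ((-1) ^ 0 * expCoeff (0 + 1)) • adPow (z t) (z' t) 0)) := by
          simp only [pow_zero, expCoeff, adPow, zero_add, Nat.factorial_one, Nat.cast_one, inv_one,
            mul_one, one_smul]
          abel
        rw [h4]
        refine sub_mem (sub_mem ?_ (sum_mem fun k _ => Submodule.smul_mem _ _ (h2 k))) ?_
        · exact (le_sup_left : A.toSubmodule ≤ _) hb
        · exact (le_sup_right : filtration (n + 2) ≤ _) (filtration_anti (by omega) h3)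
      · have : z 0 = a := by simp [hz, exp_zero, log_exp ha0]
        rw [this]
        exact (le_sup_left : A.toSubmodule ≤ _) ha
  have h1 : z 1 ∈ A.toSubmodule := mem_of_forall_mem_sup hcl fun n =>
    sup_le_sup_left (filtration_anti (Nat.le_succ n)) _ (key n 1)
  simpa [hz] using h1

/-- The group `e^A` for a closed Lie algebra `A` of series without constant term. -/
noncomputable def expGroup (A : LieSubalgebra ℂ FormalSeries)
    (hcl : IsClosed (A : Set FormalSeries)) (hA : ∀ a ∈ A, a [] = 0) : Subgroup UnitSeries where
  carrier := {g | log g.val ∈ A}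
  one_mem' := by
    rw [Set.mem_ofPred_eq, UnitSeries.coe_one, log_one]; exact zero_mem A
  inv_mem' := fun {g} hg => by
    rw [Set.mem_ofPred_eq, UnitSeries.log_inv]; exact neg_mem hg
  mul_mem' := fun {g h} hg hh => by
    have := log_exp_mul_exp_mem hcl hA hg hh
    rwa [exp_log g.nil, exp_log h.nil] at this

theorem mem_expGroup {A : LieSubalgebra ℂ FormalSeries} {hcl : IsClosed (A : Set FormalSeries)}
    {hA : ∀ a ∈ A, a [] = 0} {g : UnitSeries} : g ∈ expGroup A hcl hA ↔ log g.val ∈ A := Iff.rfl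

theorem isClosed_expGroup (A : LieSubalgebra ℂ FormalSeries)
    (hcl : IsClosed (A : Set FormalSeries)) (hA : ∀ a ∈ A, a [] = 0) :
    IsClosed (expGroup A hcl hA : Set UnitSeries) :=
  hcl.preimage UnitSeries.continuous_log

end FormalSeries

open Asymptotics

/-! ### Lie elements and coefficientwise order estimates. -/

namespace FormalSeries

theorem component_sub_mem (r : FormalSeries) (n : ℕ) :
    r - ∑ m ∈ Finset.range n, component m r ∈ filtration n := by
  intro w hw
  rw [sub_apply, sum_apply, Finset.sum_eq_single (weight w)]
  · simp [component_apply]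
  · intro m _ hm; simp [component_apply, hm.symm]
  · intro h; simp [hw] at h

theorem component_zero_of_nil {r : FormalSeries} (h : r [] = 0) : component 0 r = 0 := by
  ext w
  cases w with
  | nil => simp [component_apply, h]
  | cons i w => simp [component_apply, weight_cons]

/-- A closed Lie subalgebra containing all variables contains all Lie elements. -/
theorem lieElements_le_of_isClosed {A : LieSubalgebra ℂ FormalSeries}
    (hA : IsClosed (A : Set FormalSeries)) (hX : ∀ i, X i ∈ A) : lieElements ≤ A := by
  intro r hr
  have hfree : ∀ n, freeLie n ≤ A := fun n => LieSubalgebra.lieSpan_le.2 (by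
    rintro _ ⟨i, _, rfl⟩; exact hX i)
  refine mem_of_forall_mem_sup (A := A.toSubmodule) hA fun n => ?_
  rw [← add_sub_cancel (∑ m ∈ Finset.range n, component m r) r]
  refine Submodule.add_mem_sup (sum_mem fun m _ => ?_) (component_sub_mem r n)
  rcases Nat.eq_zero_or_pos m with rfl | hm
  · rw [component_zero_of_nil hr.1]; exact zero_mem _
  · exact hfree m (hr.2 m hm)

/-- The condition in weight `n` only sees coefficients of that weight, so it defines a subspace
containing `filtration (n + 1)`, which is automatically closed. -/
theorem isClosed_lieElements : IsClosed (lieElements : Set FormalSeries) := by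
  let C (n : ℕ) : FormalSeries →ₗ[ℂ] FormalSeries :=
    { toFun := component n
      map_add' := component_add n
      map_smul' := component_smul n }
  have h : (lieElements : Set FormalSeries) = {g | g [] = 0} ∩
      ⋂ n : ℕ, ⋂ _ : 1 ≤ n, ((freeLie n).toSubmodule.comap (C n) : Set FormalSeries) := by
    ext g
    simp only [Set.mem_inter_iff, Set.mem_iInter]
    rfl
  rw [h]
  refine (isClosed_eq (continuous_coeff []) continuous_const).inter
    (isClosed_iInter fun n => isClosed_iInter fun _ => ?_)
  refine isClosed_of_filtration_le (n := n + 1) fun f hf => ?_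
  have : C n f = 0 := by
    ext w
    change component n f w = 0
    rw [component_apply]
    split_ifs with hw
    · exact hf w (by omega)
    · rfl
  rw [Submodule.mem_comap, this]
  exact zero_mem _

/-- The element `∑ c_i X_i`. -/
noncomputable def linear (c : ℕ+ → ℂ) : FormalSeries :=
  ⟨fun w => match w with
    | [i] => c i
    | _ => 0⟩

theorem leftDeriv_linear (c : ℕ+ → ℂ) (i : ℕ+) : leftDeriv i (linear c) = c i • 1 := by
  ext w
  cases w with
  | nil => simp [linear]
  | cons j w => simp [linear]

theorem linear_nil (c : ℕ+ → ℂ) : linear c [] = 0 := rfl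

theorem linear_mul_cons (c : ℕ+ → ℂ) (f : FormalSeries) (i : ℕ+) (w : List ℕ+) :
    (linear c * f) (i :: w) = c i * f w := by
  rw [mul_cons, linear_nil, leftDeriv_linear]
  simp

theorem linear_mem_lieElements (c : ℕ+ → ℂ) : linear c ∈ lieElements := by
  refine ⟨rfl, fun n hn => ?_⟩
  obtain ⟨p, rfl⟩ : ∃ p : ℕ+, (p : ℕ) = n := ⟨⟨n, hn⟩, rfl⟩
  have : component p (linear c) = c p • X p := by
    ext w
    match w with
    | [] => simp [component_apply, linear, X]
    | [i] =>
      by_cases h : i = p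
      · subst h; simp [component_apply, weight, linear, X]
      · simp [component_apply, weight, X, h]
    | i :: j :: w => simp [component_apply, linear, X]
  rw [this]
  exact (freeLie p).smul_mem _ (LieSubalgebra.subset_lieSpan ⟨p, le_rfl, rfl⟩)

theorem lie_mem_sup_filtration_succ {A : Submodule ℂ FormalSeries} {u y : FormalSeries} {n : ℕ}
    (hu : u [] = 0) (h : ∀ a ∈ A, ⁅u, a⁆ ∈ A) (hy : y ∈ A ⊔ filtration n) :
    ⁅u, y⁆ ∈ A ⊔ filtration (n + 1) := by
  obtain ⟨a, ha, f, hf, rfl⟩ := Submodule.mem_sup.1 hy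
  rw [lie_add]
  refine Submodule.add_mem_sup (h a ha) ?_
  rw [add_comm]
  exact lie_mem_filtration (mem_filtration_one.2 hu) hf

/-- Coefficientwise `O(h ^ p)` as `h → 0`. -/
def IsBigOPow (f : ℝ → FormalSeries) (p : ℕ) : Prop :=
  ∀ w, (fun h => f h w) =O[𝓝 0] (fun h : ℝ => h ^ p)

namespace IsBigOPow

variable {f g : ℝ → FormalSeries} {p q : ℕ}

theorem mul (hf : IsBigOPow f p) (hg : IsBigOPow g q) :
    IsBigOPow (fun h => f h * g h) (p + q) := fun w => by
  simp only [mul_apply, pow_add]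
  exact IsBigO.fun_sum fun j _ => (hf _).mul (hg _)

theorem sub (hf : IsBigOPow f p) (hg : IsBigOPow g p) :
    IsBigOPow (fun h => f h - g h) p := fun w => (hf w).sub (hg w)

theorem of_continuousAt (hf : ContinuousAt f 0) : IsBigOPow f 0 := fun w => by
  simp only [pow_zero]
  exact (((continuous_coeff w).continuousAt.comp hf).tendsto).isBigO_one ℝ

theorem const (a : FormalSeries) : IsBigOPow (fun _ => a) 0 := of_continuousAt continuousAt_const

theorem mul_const (hf : IsBigOPow f p) (a : FormalSeries) : IsBigOPow (fun h => f h * a) p :=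
  hf.mul (const a)

theorem lie_const (hf : IsBigOPow f p) (a : FormalSeries) : IsBigOPow (fun h => ⁅f h, a⁆) p := by
  have := (const a).mul hf
  rw [zero_add] at this
  exact (hf.mul_const a).sub this

end IsBigOPow

end FormalSeries

/-- On the interval of integration `|s - x| ≤ |h|`, so the integrand is `O(h ^ q)`; the length of
the interval supplies one more factor. Only boundedness of `α` is used, since the coefficients of a
path need not be continuous. -/
theorem isBigO_integral_mul {α G : ℝ → ℂ} {C x : ℝ} {q : ℕ} (hα : ∀ s, ‖α s‖ ≤ C)
    (hG : (fun h => G (x + h)) =O[𝓝 0] fun h : ℝ => h ^ q) :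
    (fun h => ∫ s in x..(x + h), α s * G s) =O[𝓝 0] fun h : ℝ => h ^ (q + 1) := by
  obtain ⟨K, hK⟩ := hG.bound
  obtain ⟨δ, hδ, hball⟩ := Metric.eventually_nhds_iff.1 hK
  refine IsBigO.of_bound (C * |K|) (Metric.eventually_nhds_iff.2 ⟨δ, hδ, fun h hh => ?_⟩)
  have hC : 0 ≤ C := (norm_nonneg _).trans (hα 0)
  have hb : ∀ s ∈ Set.uIoc x (x + h), ‖α s * G s‖ ≤ C * (|K| * |h| ^ q) := by
    intro s hs
    have h1 : |s - x| ≤ |h| := by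
      rcases Set.mem_uIoc.1 hs with h' | h'
      · rw [abs_of_nonneg (by linarith), abs_of_nonneg (by linarith)]; linarith
      · rw [abs_of_nonpos (by linarith), abs_of_nonpos (by linarith)]; linarith
    have h2 := @hball (s - x) (by
      rw [Real.dist_eq, sub_zero] at hh ⊢; exact h1.trans_lt hh)
    rw [add_sub_cancel, norm_pow, Real.norm_eq_abs] at h2
    rw [norm_mul]
    refine mul_le_mul (hα s) (h2.trans ?_) (norm_nonneg _) hC
    exact mul_le_mul (le_abs_self K) (pow_le_pow_left₀ (abs_nonneg _) h1 q) (by positivity)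
      (abs_nonneg _)
  refine (intervalIntegral.norm_integral_le_of_norm_le_const hb).trans_eq ?_
  rw [add_sub_cancel_left, norm_pow, Real.norm_eq_abs, pow_succ]
  ring

/-! ### Conjugation along the solution of a path. -/

namespace PathCoeff

open FormalSeries

variable {T : ℝ}

/-- The path `a`, set to zero outside `[0, T]`. -/
noncomputable def cutoff (a : PathCoeff T) : PathCoeff T where
  toFun i := (Set.Icc 0 T).indicator (a.toFun i)
  measurable i := (a.measurable i).indicator measurableSet_Icc
  bounded := by
    obtain ⟨C, hC⟩ := a.bounded
    exact ⟨C, fun i x hx => by rw [Set.indicator_of_mem hx]; exact hC i x hx⟩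

theorem cutoff_bounded (a : PathCoeff T) (i : ℕ+) : ∃ C : ℝ, ∀ x, ‖a.cutoff.toFun i x‖ ≤ C := by
  obtain ⟨C, hC0, hC⟩ := a.exists_bound
  refine ⟨C ^ (i : ℕ), fun x => ?_⟩
  by_cases hx : x ∈ Set.Icc 0 T
  · exact (congrArg norm (Set.indicator_of_mem hx (a.toFun i))).trans_le (hC i x hx)
  · refine (congrArg norm (Set.indicator_of_notMem hx (a.toFun i))).trans_le ?_
    rw [norm_zero]; positivity

theorem cutoff_iteratedIntegral (a : PathCoeff T) (w : List ℕ+) {x : ℝ} (hx : x ∈ Set.Icc 0 T) :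
    a.cutoff.iteratedIntegral w x = a.iteratedIntegral w x := by
  induction w generalizing x with
  | nil => rfl
  | cons i w ih =>
    refine intervalIntegral.integral_congr fun s hs => ?_
    rw [Set.uIcc_of_le hx.1] at hs
    have hs' : s ∈ Set.Icc 0 T := ⟨hs.1, hs.2.trans hx.2⟩
    simp only [ih hs']
    exact congrArg (· * _) (Set.indicator_of_mem hs' (a.toFun i))

/-- Replacing a path by its cutoff makes the coefficients bounded on the whole line, so that the
solution can be studied at every real point without treating endpoints. -/
theorem cutoff_E (hT : 0 ≤ T) (a : PathCoeff T) : a.cutoff.E = a.E :=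
  UnitSeries.ext fun w => a.cutoff_iteratedIntegral w ⟨hT, le_rfl⟩

theorem intervalIntegrable_of_bounded {a : PathCoeff T}
    (hb : ∀ i, ∃ C : ℝ, ∀ x, ‖a.toFun i x‖ ≤ C) (i : ℕ+) (x y : ℝ) :
    IntervalIntegrable (a.toFun i) MeasureTheory.volume x y := by
  obtain ⟨C, hC⟩ := hb i
  rw [intervalIntegrable_iff]
  exact MeasureTheory.Measure.integrableOn_of_bounded (M := C) (by simp)
    (a.measurable i).aestronglyMeasurable (Eventually.of_forall fun s => hC s)

theorem continuous_iteratedIntegral {a : PathCoeff T}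
    (hb : ∀ i, ∃ C : ℝ, ∀ x, ‖a.toFun i x‖ ≤ C) (w : List ℕ+) :
    Continuous (a.iteratedIntegral w) := by
  induction w with
  | nil => exact continuous_const
  | cons i w ih =>
    exact intervalIntegral.continuous_primitive (fun x y =>
      (intervalIntegrable_of_bounded hb i x y).mul_continuousOn ih.continuousOn) 0

theorem continuous_solution {a : PathCoeff T} (hb : ∀ i, ∃ C : ℝ, ∀ x, ‖a.toFun i x‖ ≤ C) :
    Continuous a.solution :=
  UnitSeries.isEmbedding_val.continuous_iff.2
    (continuous_of_coeff fun w => continuous_iteratedIntegral hb w)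

theorem solution_sub_cons {a : PathCoeff T} (hb : ∀ i, ∃ C : ℝ, ∀ x, ‖a.toFun i x‖ ≤ C)
    (i : ℕ+) (w : List ℕ+) (x h : ℝ) :
    ((a.solution (x + h)).val - (a.solution x).val) (i :: w) =
      ∫ s in x..(x + h), a.toFun i s * a.iteratedIntegral w s := by
  have hI : ∀ x y, IntervalIntegrable (fun s => a.toFun i s * a.iteratedIntegral w s)
      MeasureTheory.volume x y := fun x y =>
    (intervalIntegrable_of_bounded hb i x y).mul_continuousOn
      (continuous_iteratedIntegral hb w).continuousOn
  exact intervalIntegral.integral_interval_sub_left (hI _ _) (hI _ _)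

theorem isBigOPow_solution_sub {a : PathCoeff T} (hb : ∀ i, ∃ C : ℝ, ∀ x, ‖a.toFun i x‖ ≤ C)
    (x : ℝ) : IsBigOPow (fun h => (a.solution (x + h)).val - (a.solution x).val) 1 := by
  intro w
  cases w with
  | nil => simpa using isBigO_zero _ _
  | cons i w =>
    obtain ⟨C, hC⟩ := hb i
    simp only [solution_sub_cons hb]
    refine isBigO_integral_mul (q := 0) hC ?_
    simp only [pow_zero]
    exact ((continuous_iteratedIntegral hb w).comp
      (continuous_const.add continuous_id)).continuousAt.tendsto.isBigO_one ℝ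

/-- The increment of the solution is given by the integral of the coefficients up to second
order. -/
theorem isBigOPow_solution_sub_sub {a : PathCoeff T}
    (hb : ∀ i, ∃ C : ℝ, ∀ x, ‖a.toFun i x‖ ≤ C) (x : ℝ) :
    IsBigOPow (fun h => (a.solution (x + h)).val - (a.solution x).val -
      linear (fun i => ∫ s in x..(x + h), a.toFun i s) * (a.solution x).val) 2 := by
  intro w
  cases w with
  | nil => simpa [linear_nil] using isBigO_zero _ _
  | cons i w =>
    obtain ⟨C, hC⟩ := hb i
    have h1 : (fun h => ((a.solution (x + h)).val - (a.solution x).val -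
        linear (fun i => ∫ s in x..(x + h), a.toFun i s) * (a.solution x).val) (i :: w)) =
        fun h => ∫ s in x..(x + h), a.toFun i s *
          (a.iteratedIntegral w s - a.iteratedIntegral w x) := by
      funext h
      rw [sub_apply, solution_sub_cons hb, linear_mul_cons, solution_apply,
        ← intervalIntegral.integral_mul_const, ← intervalIntegral.integral_sub]
      · simp only [mul_sub]
      · exact (intervalIntegrable_of_bounded hb i _ _).mul_continuousOn
          (continuous_iteratedIntegral hb w).continuousOn
      · exact (intervalIntegrable_of_bounded hb i _ _).mul_const _
    rw [h1]
    -- The first-order estimate for the shorter word, placed under the integral, yields second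
    -- order.
    exact isBigO_integral_mul (q := 1) hC (isBigOPow_solution_sub hb x w)

/-- Conjugation by paths preserves closed spaces that are stable under brackets with Lie
elements. -/
theorem conj_solution_mem {a : PathCoeff T} (hb : ∀ i, ∃ C : ℝ, ∀ x, ‖a.toFun i x‖ ≤ C)
    {A : Submodule ℂ FormalSeries} (hA : IsClosed (A : Set FormalSeries))
    (hL : ∀ u ∈ lieElements, ∀ v ∈ A, ⁅u, v⁆ ∈ A) {v : FormalSeries} (hv : v ∈ A) (x : ℝ) :
    (a.solution x).conj v ∈ A := by
  have key : ∀ n x, (a.solution x).conj v ∈ A ⊔ filtration n := by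
    intro n
    induction n with
    | zero => exact fun x => (le_sup_right : filtration 0 ≤ _) (mem_filtration_zero _)
    | succ n ih =>
      intro x
      by_contra hx
      obtain ⟨φ, hφ, hne, s, c, hs⟩ := exists_functional (n := n + 1) le_sup_right hx
      -- The conjugate itself need not be differentiable, as the coefficients are only measurable.
      -- But its increment is a bracket with the Lie element `u h`, which `φ` kills, plus `O(h ^
      -- 2)`, so `φ` of it has derivative zero everywhere.
      have hd : ∀ x, HasDerivAt (fun r => φ ((a.solution r).conj v)) 0 x := by
        intro x
        set y := (a.solution x).conj v with hy
        set u : ℝ → FormalSeries := fun h => linear fun i => ∫ s in x..(x + h), a.toFun i s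
        set Δ : ℝ → FormalSeries := fun h => (a.solution (x + h)).val - (a.solution x).val
        set R : ℝ → FormalSeries := fun h => Δ h - u h * (a.solution x).val
        have hΔ : IsBigOPow Δ 1 := isBigOPow_solution_sub hb x
        have hR : IsBigOPow R 2 := isBigOPow_solution_sub_sub hb x
        have hinv : IsBigOPow (fun h => ((a.solution (x + h))⁻¹).val) 0 :=
          IsBigOPow.of_continuousAt (UnitSeries.isEmbedding_val.continuous.comp
            ((continuous_solution hb).comp
              (continuous_const.add continuous_id)).inv).continuousAt
        -- Writing `F`, `F'` for the solution at `x` and `x + h`, the increment is `⁅Δ F⁻¹, y⁆ (1 -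
        -- Δ F'⁻¹)` exactly, with `Δ F⁻¹ = u + R F⁻¹`.
        have hincr : ∀ h, (a.solution (x + h)).conj v - y =
            ⁅u h, y⁆ + (⁅R h * ((a.solution x)⁻¹).val, y⁆ -
              ⁅Δ h * ((a.solution x)⁻¹).val, y⁆ * (Δ h * ((a.solution (x + h))⁻¹).val)) := by
          intro h
          have hFG := UnitSeries.mul_inv_val (a.solution x)
          have hGF := UnitSeries.inv_mul_val (a.solution x)
          have hFG' := UnitSeries.mul_inv_val (a.solution (x + h))
          have e1 : R h * ((a.solution x)⁻¹).val = Δ h * ((a.solution x)⁻¹).val - u h := by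
            rw [sub_mul, mul_assoc, hFG, mul_one]
          have e2 : 1 - Δ h * ((a.solution (x + h))⁻¹).val =
              (a.solution x).val * ((a.solution (x + h))⁻¹).val := by
            rw [sub_mul, hFG', sub_sub_cancel]
          have e3 : ⁅Δ h * ((a.solution x)⁻¹).val, y⁆ =
              (a.solution (x + h)).val * v * ((a.solution x)⁻¹).val -
                y * (a.solution (x + h)).val * ((a.solution x)⁻¹).val := by
            have h3 : ((a.solution x)⁻¹).val * y = v * ((a.solution x)⁻¹).val := by
              rw [hy, UnitSeries.conj, ← mul_assoc, ← mul_assoc, hGF, one_mul]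
            have h4 : Δ h * ((a.solution x)⁻¹).val =
                (a.solution (x + h)).val * ((a.solution x)⁻¹).val - 1 := by
              rw [sub_mul, hFG]
            rw [h4, Ring.lie_def, sub_mul, mul_sub, mul_assoc, h3]
            noncomm_ring
          have e4 : ∀ z : FormalSeries, z * ((a.solution x)⁻¹).val *
              ((a.solution x).val * ((a.solution (x + h))⁻¹).val) =
              z * ((a.solution (x + h))⁻¹).val := fun z => by
            rw [mul_assoc, ← mul_assoc _ (a.solution x).val, hGF, one_mul]
          calc (a.solution (x + h)).conj v - y
              = ⁅Δ h * ((a.solution x)⁻¹).val, y⁆ *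
                  (1 - Δ h * ((a.solution (x + h))⁻¹).val) := by
                rw [e2, e3, sub_mul, e4, e4, mul_assoc y, hFG', mul_one]; rfl
            _ = _ := by
                rw [e1, sub_lie, mul_sub, mul_one]; abel
        have hO : IsBigOPow (fun h => ⁅R h * ((a.solution x)⁻¹).val, y⁆ -
              ⁅Δ h * ((a.solution x)⁻¹).val, y⁆ * (Δ h * ((a.solution (x + h))⁻¹).val)) 2 :=
          ((hR.mul_const _).lie_const y).sub (((hΔ.mul_const _).lie_const y).mul (hΔ.mul hinv))
        rw [hasDerivAt_iff_isLittleO_nhds_zero]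
        have h1 : (fun h : ℝ => φ ((a.solution (x + h)).conj v) - φ ((a.solution x).conj v) -
            h • (0 : ℂ)) = fun h => ∑ w ∈ s, c w * (⁅R h * ((a.solution x)⁻¹).val, y⁆ -
              ⁅Δ h * ((a.solution x)⁻¹).val, y⁆ * (Δ h * ((a.solution (x + h))⁻¹).val)) w := by
          funext h
          rw [smul_zero, sub_zero, ← map_sub, ← hy, hincr, map_add,
            hφ _ (lie_mem_sup_filtration_succ rfl (hL _ (linear_mem_lieElements _)) (ih x)),
            zero_add, hs]
        rw [h1]
        have h2 : (fun h : ℝ => h ^ 2) =o[𝓝 0] fun h : ℝ => h := by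
          simpa using isLittleO_pow_pow (𝕜 := ℝ) (show 1 < 2 by norm_num)
        exact (IsBigO.fun_sum fun w _ => (hO w).const_mul_left (c w)).trans_isLittleO h2
      have h0 := is_const_of_deriv_eq_zero (fun t => (hd t).differentiableAt)
        (fun t => (hd t).deriv) x 0
      refine hne (h0.trans (hφ _ ?_))
      have : a.solution 0 = 1 := by
        refine UnitSeries.ext fun w => ?_
        cases w with
        | nil => rfl
        | cons i w => rw [solution_apply]; simp [iteratedIntegral]
      rw [this, UnitSeries.conj]
      simpa using (le_sup_left : A ≤ A ⊔ filtration (n + 1)) hv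
  exact mem_of_forall_mem_sup hA fun n => key n x

end PathCoeff

/-! ### Constant paths. -/

namespace PathCoeff

open FormalSeries

/-- The path with constant coefficient `c` at `X_i`. -/
noncomputable def single (T : ℝ) (i : ℕ+) (c : ℂ) : PathCoeff T where
  toFun j _ := if j = i then c else 0
  measurable _ := measurable_const
  bounded := by
    refine ⟨max 1 ‖c‖, fun j x _ => ?_⟩
    split_ifs
    · exact (le_max_right 1 ‖c‖).trans (le_self_pow₀ (le_max_left _ _) j.ne_zero)
    · rw [norm_zero]; positivity

/-- The exponential obeys the same recursion as the iterated integrals: the derivative of its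
coefficient at `j :: w` is the coefficient at `w`, times `c` if `j = i` and zero otherwise. -/
theorem single_iteratedIntegral (T : ℝ) (i : ℕ+) (c : ℂ) (w : List ℕ+) (x : ℝ) :
    (single T i c).iteratedIntegral w x = exp ((x : ℂ) • c • X i) w := by
  have h0 : (c • X i) [] = 0 := by simp [X]
  have h0' : ∀ s : ℝ, ((s : ℂ) • c • X i) [] = 0 := fun s => by
    rw [smul_apply, h0, mul_zero]
  induction w generalizing x with
  | nil => rw [exp_nil (h0' x)]; rfl
  | cons j w ih =>
    have hlin : c • X i = linear fun j => if j = i then c else 0 := by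
      ext v
      match v with
      | [] => simp [linear, X]
      | [j] => simp [linear, X]
      | j :: k :: v => simp [linear, X]
    have hd : ∀ s : ℝ, HasDerivAt (fun s : ℝ => exp ((s : ℂ) • c • X i) (j :: w))
        ((single T i c).toFun j s * (single T i c).iteratedIntegral w s) s := by
      intro s
      have h := HasDeriv.exp_smul h0 s (j :: w)
      -- The factor `c • X i` is moved to the left so that it strips the first letter.
      rw [(commute_exp (h0' s) ((Commute.refl (c • X i)).smul_left _)).eq] at h
      convert h using 1
      rw [ih]
      conv_rhs => rw [hlin]
      rw [linear_mul_cons, ← hlin]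
      rfl
    have hc : Continuous fun s : ℝ =>
        (single T i c).toFun j s * (single T i c).iteratedIntegral w s := by
      refine continuous_const.mul (continuous_iff_continuousAt.2 fun s => ?_)
      rw [show (single T i c).iteratedIntegral w = fun s : ℝ => exp ((s : ℂ) • c • X i) w from
        funext ih]
      exact (HasDeriv.exp_smul h0 s w).continuousAt
    change (∫ s in (0 : ℝ)..x, _) = _
    rw [intervalIntegral.integral_eq_sub_of_hasDerivAt (fun s _ => hd s)
      (hc.intervalIntegrable _ _)]
    simp [-Complex.coe_smul, exp_zero]

end PathCoeff

/-! ### The closure of `H_R` and the normality criterion. -/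

open FormalSeries

theorem isClosed_formalPathGroup {T : ℝ} (hT : 0 < T) :
    IsClosed (formalPathGroup hT : Set UnitSeries) := Subgroup.isClosed_topologicalClosure _

/-- The Lie algebra of a closed subgroup is closed, so the variables suffice; `e^{c X_i}` is the
endpoint of the constant path `c / T` run for time `T`. -/
theorem lieElements_le_lieAlgebra_formalPathGroup {T : ℝ} (hT : 0 < T) :
    lieElements ≤ UnitSeries.lieAlgebra (formalPathGroup hT) (isClosed_formalPathGroup hT) := by
  refine lieElements_le_of_isClosed (UnitSeries.isClosed_lieAlgebra _ _) fun i =>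
    ⟨rfl, fun c => Subgroup.le_topologicalClosure _ ⟨PathCoeff.single T i (c / T), ?_⟩⟩
  refine UnitSeries.ext fun w => ?_
  have hT' : (T : ℂ) ≠ 0 := Complex.ofReal_ne_zero.2 hT.ne'
  rw [UnitSeries.ofExp_val (by simp [X])]
  refine (PathCoeff.single_iteratedIntegral T i _ w T).trans ?_
  rw [smul_smul, mul_div_cancel₀ _ hT']

theorem lieExp_eq_ofExp (r : lieElements) : lieExp r = UnitSeries.ofExp (r : FormalSeries) :=
  UnitSeries.val_injective (UnitSeries.ofExp_val r.2.1).symm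

theorem subset_closedLieSpan (R : Set lieElements) : R ⊆ closedLieSpan R := fun r hr => by
  rw [closedLieSpan, LieSubalgebra.coe_sInf]
  exact Set.mem_iInter₂.2 fun A hA => hA.2 hr

theorem closedLieSpan_le {R : Set lieElements} {A : LieSubalgebra ℂ lieElements}
    (hA : IsClosed (A : Set lieElements)) (hR : R ⊆ A) : closedLieSpan R ≤ A :=
  sInf_le ⟨hA, hR⟩

theorem isClosed_closedLieSpan (R : Set lieElements) :
    IsClosed (closedLieSpan R : Set lieElements) := by
  rw [closedLieSpan, LieSubalgebra.coe_sInf]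
  exact isClosed_biInter fun A hA => hA.1

/-- `A_R` as a Lie algebra of series. -/
noncomputable def closedLieSpanMap (R : Set lieElements) : LieSubalgebra ℂ FormalSeries :=
  (closedLieSpan R).map lieElements.incl

theorem mem_closedLieSpanMap {R : Set lieElements} {a : lieElements} :
    (a : FormalSeries) ∈ closedLieSpanMap R ↔ a ∈ closedLieSpan R := by
  refine ⟨?_, fun h => ⟨a, h, rfl⟩⟩
  rintro ⟨b, hb, h⟩
  rwa [← Subtype.ext h]

theorem closedLieSpanMap_le (R : Set lieElements) : closedLieSpanMap R ≤ lieElements := by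
  rintro _ ⟨a, _, rfl⟩; exact a.2

theorem isClosed_closedLieSpanMap (R : Set lieElements) :
    IsClosed (closedLieSpanMap R : Set FormalSeries) :=
  (isClosed_lieElements.isClosedEmbedding_subtypeVal.isClosedMap _ (isClosed_closedLieSpan R))

theorem expSubgroup_le_formalPathGroup {T : ℝ} (hT : 0 < T) (R : Set lieElements) :
    expSubgroup R ≤ formalPathGroup hT := by
  refine (Subgroup.closure_le _).2 ?_
  rintro _ ⟨r, _, c, rfl⟩
  rw [lieExp_eq_ofExp]
  exact (lieElements_le_lieAlgebra_formalPathGroup hT r.2).2 c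

/-- The closure of `H_R` in `G` is `e^{A_R}`. -/
theorem mem_topologicalClosure_expSubgroup {R : Set lieElements} {g : UnitSeries} :
    g ∈ (expSubgroup R).topologicalClosure ↔ log g.val ∈ closedLieSpanMap R := by
  constructor
  -- `e^{A_R}` is a closed group containing the generators of `H_R`.
  · have hle : expSubgroup R ≤ expGroup (closedLieSpanMap R) (isClosed_closedLieSpanMap R)
        (fun a ha => (closedLieSpanMap_le R ha).1) := by
      refine (Subgroup.closure_le _).2 ?_
      rintro _ ⟨r, hr, c, rfl⟩
      rw [lieExp_eq_ofExp, SetLike.mem_coe, mem_expGroup,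
        UnitSeries.log_ofExp (c • r).2.1]
      exact mem_closedLieSpanMap.2 ((closedLieSpan R).smul_mem c (subset_closedLieSpan R hr))
    exact fun h => Subgroup.topologicalClosure_minimal _ hle (isClosed_expGroup _ _ _) h
  · intro h
    have hcl := Subgroup.isClosed_topologicalClosure (expSubgroup R)
    -- Minimality of `A_R` is applied to the Lie algebra of the closure of `H_R`, which is closed
    -- and contains `R`.
    have hle : closedLieSpan R ≤
        (UnitSeries.lieAlgebra (expSubgroup R).topologicalClosure hcl).comap lieElements.incl := by
      refine closedLieSpan_le
        ((UnitSeries.isClosed_lieAlgebra _ hcl).preimage continuous_subtype_val) fun r hr => ?_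
      refine ⟨r.2.1, fun c => Subgroup.le_topologicalClosure _ (Subgroup.subset_closure ?_)⟩
      exact ⟨r, hr, c, (lieExp_eq_ofExp (c • r)).symm⟩
    obtain ⟨a, ha, hag⟩ := h
    rw [← UnitSeries.ofExp_log g, ← hag]
    exact UnitSeries.ofExp_mem_of_mem_lieAlgebra (hK := hcl) (hle ha)

/-- Closure in the subspace `G_f(X)` is the trace of the closure in `G`, and `H_R` already lies in
`G_f(X)`. -/
theorem mem_closedExpSubgroup {T : ℝ} (hT : 0 < T) {R : Set lieElements}
    {h : formalPathGroup hT} :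
    h ∈ closedExpSubgroup hT R ↔ log (h : UnitSeries).val ∈ closedLieSpanMap R := by
  have e : ((↑) '' ((expSubgroup R).subgroupOf (formalPathGroup hT) : Set (formalPathGroup hT)) :
      Set UnitSeries) = expSubgroup R := by
    ext g
    refine ⟨?_, fun hg => ⟨⟨g, expSubgroup_le_formalPathGroup hT R hg⟩, hg, rfl⟩⟩
    rintro ⟨x, hx, rfl⟩
    exact hx
  rw [← mem_topologicalClosure_expSubgroup, closedExpSubgroup, ← SetLike.mem_coe,
    ← SetLike.mem_coe, Subgroup.topologicalClosure_coe, Subgroup.topologicalClosure_coe,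
    closure_subtype, e]

theorem image_log_closedExpSubgroup {T : ℝ} (hT : 0 < T) (R : Set lieElements) :
    (fun h : formalPathGroup hT => log ((h : UnitSeries) : FormalSeries)) ''
        (closedExpSubgroup hT R : Set (formalPathGroup hT)) = closedLieSpanMap R := by
  ext a
  constructor
  · rintro ⟨h, hh, rfl⟩
    exact (mem_closedExpSubgroup hT).1 hh
  · intro ha
    have ha' := closedLieSpanMap_le R ha
    have hlog := UnitSeries.log_ofExp ha'.1
    exact ⟨⟨UnitSeries.ofExp a, UnitSeries.ofExp_mem_of_mem_lieAlgebra
      (lieElements_le_lieAlgebra_formalPathGroup hT ha')⟩,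
      (mem_closedExpSubgroup hT).2 (by rwa [hlog]), hlog⟩

/-- Conjugating `e^a` by `e^{sx}`, which is a formal path, and taking logarithms puts `e^{sx} a
e^{-sx}` in the closed space `A_R`; the bracket is its derivative at `s = 0`. -/
theorem lie_mem_of_normal {T : ℝ} (hT : 0 < T) {R : Set lieElements}
    (hn : (closedExpSubgroup hT R).Normal) {x a : FormalSeries} (hx : x ∈ lieElements)
    (ha : a ∈ closedLieSpanMap R) : ⁅x, a⁆ ∈ closedLieSpanMap R := by
  have ha' := closedLieSpanMap_le R ha
  refine (UnitSeries.hasDeriv_conj_ofExp hx.1 a).mem_of_forall_mem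
    (W := (closedLieSpanMap R).toSubmodule) (isClosed_closedLieSpanMap R) fun s => ?_
  have hmem : ∀ y ∈ lieElements, UnitSeries.ofExp y ∈ formalPathGroup hT := fun y hy =>
    UnitSeries.ofExp_mem_of_mem_lieAlgebra (lieElements_le_lieAlgebra_formalPathGroup hT hy)
  have h := hn.conj_mem ⟨_, hmem a ha'⟩
    ((mem_closedExpSubgroup hT).2 (by rwa [UnitSeries.log_ofExp ha'.1]))
    ⟨_, hmem _ (lieElements.smul_mem (s : ℂ) hx)⟩
  rw [mem_closedExpSubgroup] at h
  have e : log (UnitSeries.ofExp ((UnitSeries.ofExp ((s : ℂ) • x)).conj a)).val ∈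
      closedLieSpanMap R := by
    rw [UnitSeries.ofExp_conj _ ha'.1]
    exact h
  rwa [UnitSeries.log_ofExp (by rw [UnitSeries.conj_nil, ha'.1])] at e

/-- For actual paths this is `conj_solution_mem` at time `T`; the condition on `g` is closed, so it
passes to limits of paths. -/
theorem conj_mem_of_mem_formalPathGroup {T : ℝ} (hT : 0 < T) {A : Submodule ℂ FormalSeries}
    (hA : IsClosed (A : Set FormalSeries)) (hL : ∀ u ∈ lieElements, ∀ v ∈ A, ⁅u, v⁆ ∈ A)
    {g : UnitSeries} (hg : g ∈ formalPathGroup hT) {v : FormalSeries} (hv : v ∈ A) :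
    g.conj v ∈ A := by
  have hc : Continuous fun g : UnitSeries => g.conj v :=
    (UnitSeries.isEmbedding_val.continuous.mul continuous_const).mul
      (UnitSeries.isEmbedding_val.continuous.comp continuous_inv)
  refine closure_minimal (t := {g : UnitSeries | g.conj v ∈ A}) ?_ (hA.preimage hc) hg
  rintro _ ⟨a, rfl⟩
  rw [← a.cutoff_E hT.le]
  exact PathCoeff.conj_solution_mem a.cutoff_bounded hA hL hv T

/-- Membership is read off the logarithm, and `log (g h g⁻¹) = g (log h) g⁻¹`. -/
theorem normal_of_lie_mem {T : ℝ} (hT : 0 < T) {R : Set lieElements}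
    (hL : ∀ u ∈ lieElements, ∀ v ∈ closedLieSpanMap R, ⁅u, v⁆ ∈ closedLieSpanMap R) :
    (closedExpSubgroup hT R).Normal where
  conj_mem h hh g := by
    rw [mem_closedExpSubgroup] at hh ⊢
    have h0 := log_nil (h : UnitSeries).nil
    have h1 := conj_mem_of_mem_formalPathGroup hT (A := (closedLieSpanMap R).toSubmodule)
      (isClosed_closedLieSpanMap R) hL g.2 hh
    have h2 := UnitSeries.ofExp_conj g h0
    rw [UnitSeries.ofExp_log] at h2
    have h3 := UnitSeries.log_ofExp (a := (g : UnitSeries).conj (log (h : UnitSeries).val))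
      (by rw [UnitSeries.conj_nil, h0])
    rw [h2] at h3
    exact h3 ▸ h1

theorem proposition2p22 {T : ℝ} (hT : 0 < T) (R : Set lieElements) :
    expSubgroup R ≤ formalPathGroup hT ∧
    (fun h : formalPathGroup hT => FormalSeries.log ((h : UnitSeries) : FormalSeries)) ''
        (closedExpSubgroup hT R : Set (formalPathGroup hT)) =
      (fun a : lieElements => (a : FormalSeries)) '' (closedLieSpan R : Set lieElements) ∧
    ((closedExpSubgroup hT R).Normal ↔
      ∃ J : LieIdeal ℂ lieElements, J.toLieSubalgebra = closedLieSpan R) := by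
  refine ⟨expSubgroup_le_formalPathGroup hT R, image_log_closedExpSubgroup hT R, fun hn => ?_, ?_⟩
  · refine ⟨{ (closedLieSpan R).toSubmodule with lie_mem := fun {x a} ha => ?_ }, rfl⟩
    exact mem_closedLieSpanMap.1 (lie_mem_of_normal hT hn x.2 (mem_closedLieSpanMap.2 ha))
  · rintro ⟨J, hJ⟩
    refine normal_of_lie_mem hT fun u hu v hv => ?_
    obtain ⟨v, hv, rfl⟩ := hv
    refine ⟨⁅(⟨u, hu⟩ : lieElements), v⁆, ?_, rfl⟩
    have hv' : v ∈ closedLieSpan R := hv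
    rw [← hJ] at hv'
    change _ ∈ closedLieSpan R
    rw [← hJ]
    exact lie_mem_right ℂ lieElements J _ _ hv'
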